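/- **Conventions.** A *hyperring* is a set with a commutative multiplicative monoid structure with unit $1$ and absorbing element $0\neq 1$, and a commutative, associative multivalued addition with non-empty values, neutral element $0$, unique opposites and reversibility, such that $r(x+y)=rx+ry$ as sets. A *sheaf of hyperrings* on a space is a sheaf of sets with sections $0,1$ and with a multiplication and a multivalued addition whose graphs are subsheaves, such that all stalks are hyperrings. An isomorphism of sheaves of hyperrings is an isomorphism of sheaves of sets that identifies these sections and graphs. Let $\mathbb Q^{\rm cyc}$ be the field generated over $\mathbb Q$ by all roots of unity, $\mathcal O^{\rm cyc}$ its ring of integers, and $\pi:{\rm Spec}\,\mathcal O^{\rm cyc}\to{\rm Spec}\,\mathbb Z$ the canonical map. For a prime $p$ let $H(p)\subset\mathbb Q$ be the group of fractions whose denominator is a power of $p$. *Cartier side.* Let $\mathcal{C}a\mathcal{C}\ell({\rm Spec}\,\mathcal O^{\rm cyc})=\mathcal K/\mathcal O^\times$, where $\mathcal K$ is the constant sheaf $\mathbb Q^{\rm cyc}$: its stalk at $\wp$ is the quotient $\mathbb Q^{\rm cyc}/(\mathcal O^{\rm cyc}_\wp)^\times$, in which the sum of two classes is the set of classes of all sums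 of representatives, and its sections are the families of elements of the stalks that are locally the class of one element of $\mathbb Q^{\rm cyc}$. *Arithmetic site side.* Let $\mathbb N_0^\times$ be the multiplicative monoid of non-negative integers. Let $\mathcal S$ be the sheaf on ${\rm Spec}\,\mathbb Z$ whose sections over $U$ are the families $\xi_p\in H(p)^+=\{h\in H(p): h\ge 0\}$, for the primes $p\in U$, with only finitely many non-zero terms; its stalk is $H(p)^+$ at $p$ and $\{0\}$ at the generic point, and $\mathbb N_0^\times$ acts by multiplication. Let $\Theta:{\rm Spec}\,\mathbb Z\to\widehat{\mathbb N_0^\times}$ be the geometric morphism, to the topos of sets with an action of $\mathbb N_0^\times$, that $\mathcal S$ defines: $\Theta^*A$ is the sheaf associated with $U\mapsto A\otimes_{\mathbb N_0^\times}\Gamma(U,\mathcal S)$. Let $\mathcal O_h$ be the set $\mathbb Z\cup\{-\infty\}$, where $k\in\mathbb N_0^\times$ acts by $m\mapsto km$ and fixes $-\infty$, with product the addition of $\mathbb Z$ (absorbing element $-\infty$) and multivalued sum $x\vee y=\max(x,y)$ for $x\ne y$, $x\vee x=[-\infty,x]$. The sheaf $(\Theta\circ\pi)^*(\mathcal O_h)=\pi^*\Theta^*(\mathcal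 O_h)$ carries the inverse images of these operations. For $\pi(\wp)=p$, its stalk at $\wp$ is mapped to $H(p)\cup\{-\infty\}$ by $x\otimes h\mapsto xh$. **Proposition.** 1. For every prime $p$ and every prime ideal $\wp$ of $\mathcal O^{\rm cyc}$ above $p$ there is exactly one valuation $v_\wp:\mathbb Q^{\rm cyc}\to\mathbb Q\cup\{\infty\}$ with valuation ring $\mathcal O^{\rm cyc}_\wp$ and $v_\wp(p)=p-1$, and $v_\wp\big((\mathbb Q^{\rm cyc})^\times\big)=H(p)$. 2. $\mathcal{C}a\mathcal{C}\ell({\rm Spec}\,\mathcal O^{\rm cyc})$ and $(\Theta\circ\pi)^*(\mathcal O_h)$ are sheaves of hyperrings on ${\rm Spec}\,\mathcal O^{\rm cyc}$, and there is exactly one isomorphism of sheaves of hyperrings $$\Phi:\ \mathcal{C}a\mathcal{C}\ell({\rm Spec}\,\mathcal O^{\rm cyc})\ \stackrel{\sim}{\longrightarrow}\ (\Theta\circ\pi)^*(\mathcal O_h)$$ such that, whenever a section $s$ has at a closed point $\wp$ the class of $f\in\mathbb Q^{\rm cyc}$ as its germ, the germ of $\Phi(s)$ at $\wp$ has the value $-v_\wp(f)\in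 H(p)\cup\{-\infty\}$. -/

import Mathlib

open CategoryTheory TopologicalSpace Opposite

/-! ### Hyperrings and sheaves of hyperrings -/

/-- Two constants, a multiplication and a multivalued addition on `A`, given by their graphs:
`mul x y z` reads "`z` is the product of `x` and `y`" and `add x y z` reads "`z ∈ x + y`".
Graphs are used because an inverse image functor of topoi transports subobjects. -/
structure HyperStr (A : Type) where
  zero : A
  one : A
  mul : A → A → A → Prop
  add : A → A → A → Prop

/-- The axioms of a commutative (Krasner) hyperring: `(A, +, 0)` is a canonical hypergroup,
`(A, ·, 1)` is a commutative monoid with absorbing element `0 ≠ 1`,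
and `r (x + y) = r x + r y` as sets. -/
structure HyperStr.IsHyperring {A : Type} (h : HyperStr A) : Prop where
  add_nonempty : ∀ x y, ∃ z, h.add x y z
  add_comm : ∀ x y z, h.add x y z → h.add y x z
  add_zero : ∀ x z, h.add x h.zero z ↔ z = x
  add_assoc : ∀ x y z w,
    (∃ t, h.add x y t ∧ h.add t z w) ↔ (∃ t, h.add y z t ∧ h.add x t w)
  exists_unique_neg : ∀ x, ∃! y, h.add x y h.zero
  reversible : ∀ x x' y z, h.add x x' h.zero → h.add x y z → h.add z x' y
  mul_existsUnique : ∀ x y, ∃! z, h.mul x y z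
  mul_comm : ∀ x y z, h.mul x y z → h.mul y x z
  mul_assoc : ∀ x y z a b w, h.mul x y a → h.mul y z b → (h.mul a z w ↔ h.mul x b w)
  mul_one : ∀ x, h.mul x h.one x
  mul_zero : ∀ x, h.mul x h.zero h.zero
  distrib : ∀ r x y a b w, h.mul r x a → h.mul r y b →
    (h.add a b w ↔ ∃ z, h.add x y z ∧ h.mul r z w)
  zero_ne_one : h.zero ≠ h.one

/-- A sheaf of sets on `X`, presented by its stalks and by those families of germs which are
sections, together with constants, a multiplication and a multivalued addition on the stalks. -/
structure HyperSheaf (X : TopCat.{0}) where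
  stalk : X → Type
  sec : TopCat.LocalPredicate stalk
  str : ∀ x, HyperStr (stalk x)

namespace HyperSheaf

variable {X : TopCat.{0}}

/-- The underlying sheaf of sets. -/
def toSheaf (F : HyperSheaf X) : TopCat.Sheaf Type X := TopCat.subsheafToTypes F.sec

/-- The set of sections over `U`. -/
abbrev Sections (F : HyperSheaf X) (U : Opens X) : Type := F.toSheaf.presheaf.obj (op U)

/-- The germ at `x` of a section. -/
def germ (F : HyperSheaf X) {U : Opens X} (s : F.Sections U) (x : U) : F.stalk x.1 :=
  (show {f : ∀ x : U, F.stalk x.1 // F.sec.pred f} from s).1 x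

/-- `F` is a sheaf of hyperrings: `F.stalk x` is really the stalk at `x` of the sheaf of sections
(every element is the germ of a local section, and two sections with the same germ at `x` agree
near `x`), the constants are sections, the graphs of the operations are subsheaves, and all stalks
are hyperrings. -/
structure IsSheafOfHyperrings (F : HyperSheaf X) : Prop where
  exists_germ : ∀ (x : X) (t : F.stalk x), ∃ (U : Opens X) (hx : x ∈ U) (s : F.Sections U),
    F.germ s ⟨x, hx⟩ = t
  germ_ext : ∀ (U : Opens X) (s t : F.Sections U) (x : U), F.germ s x = F.germ t x →
    ∃ V : Opens X, x.1 ∈ V ∧ ∀ (y : U), y.1 ∈ V → F.germ s y = F.germ t y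
  zero_sec : ∀ U : Opens X, F.sec.pred fun x : U => (F.str x.1).zero
  one_sec : ∀ U : Opens X, F.sec.pred fun x : U => (F.str x.1).one
  mul_open : ∀ (U : Opens X) (r s t : F.Sections U) (x : U),
    (F.str x.1).mul (F.germ r x) (F.germ s x) (F.germ t x) →
    ∃ V : Opens X, x.1 ∈ V ∧ ∀ (y : U), y.1 ∈ V →
      (F.str y.1).mul (F.germ r y) (F.germ s y) (F.germ t y)
  add_open : ∀ (U : Opens X) (r s t : F.Sections U) (x : U),
    (F.str x.1).add (F.germ r x) (F.germ s x) (F.germ t x) →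
    ∃ V : Opens X, x.1 ∈ V ∧ ∀ (y : U), y.1 ∈ V →
      (F.str y.1).add (F.germ r y) (F.germ s y) (F.germ t y)
  hyperring : ∀ x, (F.str x).IsHyperring

/-- `t` is the product of the sections `r` and `s`. -/
def MulSec (F : HyperSheaf X) {U : Opens X} (r s t : F.Sections U) : Prop :=
  ∀ x : U, (F.str x.1).mul (F.germ r x) (F.germ s x) (F.germ t x)

/-- `t` belongs to the hypersum of the sections `r` and `s`. -/
def AddSec (F : HyperSheaf X) {U : Opens X} (r s t : F.Sections U) : Prop :=
  ∀ x : U, (F.str x.1).add (F.germ r x) (F.germ s x) (F.germ t x)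

/-- `s` is the zero section. -/
def IsZeroSec (F : HyperSheaf X) {U : Opens X} (s : F.Sections U) : Prop :=
  ∀ x : U, F.germ s x = (F.str x.1).zero

/-- `s` is the unit section. -/
def IsOneSec (F : HyperSheaf X) {U : Opens X} (s : F.Sections U) : Prop :=
  ∀ x : U, F.germ s x = (F.str x.1).one

/-- The image of a section under an isomorphism of sheaves of sets. -/
def mapSec {F G : HyperSheaf X} (Φ : F.toSheaf ≅ G.toSheaf) {U : Opens X} (s : F.Sections U) :
    G.Sections U :=
  Φ.hom.hom.app (op U) s

/-- An isomorphism of sheaves of sets is an isomorphism of sheaves of hyperrings when it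
identifies the constants and the graphs of the two operations. -/
structure IsHyperringIso {F G : HyperSheaf X} (Φ : F.toSheaf ≅ G.toSheaf) : Prop where
  zero_iff : ∀ {U : Opens X} (s : F.Sections U), F.IsZeroSec s ↔ G.IsZeroSec (mapSec Φ s)
  one_iff : ∀ {U : Opens X} (s : F.Sections U), F.IsOneSec s ↔ G.IsOneSec (mapSec Φ s)
  mul_iff : ∀ {U : Opens X} (r s t : F.Sections U),
    F.MulSec r s t ↔ G.MulSec (mapSec Φ r) (mapSec Φ s) (mapSec Φ t)
  add_iff : ∀ {U : Opens X} (r s t : F.Sections U),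
    F.AddSec r s t ↔ G.AddSec (mapSec Φ r) (mapSec Φ s) (mapSec Φ t)

/-- The inverse image of `F` under a continuous map `f : Y ⟶ X`: the stalk at `y` is the stalk
of `F` at `f y`, and the sections are locally of the form `s ∘ f` with `s` a section of `F`. -/
def inverseImage {Y : TopCat.{0}} (f : Y ⟶ X) (F : HyperSheaf X) : HyperSheaf Y where
  stalk y := F.stalk (f y)
  sec := TopCat.PrelocalPredicate.sheafify
    { pred := fun {U} t => ∃ (V : Opens X) (h : ∀ y : U, f y.1 ∈ V) (s : F.Sections V),
        ∀ y : U, t y = F.germ s ⟨f y.1, h y⟩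
      res := fun i _ ⟨V, h, s, hs⟩ =>
        ⟨V, fun y => h ⟨y.1, i.le y.2⟩, s, fun y => hs ⟨y.1, i.le y.2⟩⟩ }
  str y := F.str (f y)

end HyperSheaf

/-! ### The sheaf of hyperrings `𝒦 / 𝒪ˣ` of Cartier divisor classes -/

/-- The quotient `A / G` of a commutative ring by a subgroup of its group of units. -/
abbrev UnitQuotient (A : Type) [CommRing A] (G : Subgroup Aˣ) : Type :=
  MulAction.orbitRel.Quotient G A

/-- The class of `a` in `A / G`. -/
def UnitQuotient.mk {A : Type} [CommRing A] (G : Subgroup Aˣ) (a : A) : UnitQuotient A G :=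
  Quotient.mk (MulAction.orbitRel G A) a

/-- The hyperring structure of `A / G`: products of classes are classes of products, and the
hypersum of two classes consists of the classes of all sums of representatives. -/
def UnitQuotient.str (A : Type) [CommRing A] (G : Subgroup Aˣ) : HyperStr (UnitQuotient A G) where
  zero := mk G 0
  one := mk G 1
  mul x y z := ∃ a b : A, mk G a = x ∧ mk G b = y ∧ mk G (a * b) = z
  add x y z := ∃ a b : A, mk G a = x ∧ mk G b = y ∧ mk G (a + b) = z

section CartierDivisors

variable (R K : Type) [CommRing R] [IsDomain R] [Field K] [Algebra R K] [IsFractionRing R K]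

/-- The local ring of `Spec R` at `x`, inside the fraction field `K` of `R`. -/
def localRing (x : PrimeSpectrum R) : Set K :=
  {f | ∃ a b : R, b ∉ x.asIdeal ∧ f * algebraMap R K b = algebraMap R K a}

/-- The units of the local ring of `Spec R` at `x`, as a subgroup of `Kˣ`. -/
def localUnits (x : PrimeSpectrum R) : Subgroup Kˣ where
  carrier := {u | (u : K) ∈ localRing R K x ∧ ((u⁻¹ : Kˣ) : K) ∈ localRing R K x}
  one_mem' := by
    have h : (1 : R) ∉ x.asIdeal := (Ideal.ne_top_iff_one _).mp x.isPrime.ne_top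
    exact ⟨⟨1, 1, h, by simp⟩, ⟨1, 1, h, by simp⟩⟩
  mul_mem' := by
    have key : ∀ f g : K, f ∈ localRing R K x → g ∈ localRing R K x →
        f * g ∈ localRing R K x := by
      rintro f g ⟨a, b, hb, h⟩ ⟨a', b', hb', h'⟩
      refine ⟨a * a', b * b', fun hm => ?_, ?_⟩
      · rcases x.isPrime.mem_or_mem hm with h1 | h1
        · exact hb h1
        · exact hb' h1
      · rw [map_mul, map_mul, ← h, ← h']; ring
    rintro u v ⟨hu, hu'⟩ ⟨hv, hv'⟩
    refine ⟨?_, ?_⟩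
    · rw [Units.val_mul]; exact key _ _ hu hv
    · rw [mul_inv, Units.val_mul]; exact key _ _ hu' hv'
  inv_mem' := by
    rintro u ⟨hu, hu'⟩
    exact ⟨hu', by rwa [inv_inv]⟩

/-- The sheaf of hyperrings `𝒦 / 𝒪ˣ` on the integral scheme `Spec R`. Here `𝒦` is the constant
sheaf `K`, the stalk at `x` is `K / 𝒪ₓˣ`, and a section of the quotient sheaf is a family of
elements of these stalks which is locally the class of one element of `K`. -/
def cartierSheaf : HyperSheaf (TopCat.of (PrimeSpectrum R)) where
  stalk x := UnitQuotient K (localUnits R K x)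
  sec := TopCat.PrelocalPredicate.sheafify
    { pred := fun {U} s => ∃ f : K, ∀ x : U, s x = UnitQuotient.mk (localUnits R K x.1) f
      res := fun i _ ⟨f, hf⟩ => ⟨f, fun x => hf ⟨x.1, i.le x.2⟩⟩ }
  str x := UnitQuotient.str K (localUnits R K x)

end CartierDivisors

/-! ### The morphism `Θ` from `Spec ℤ` to the topos of sets with an action of the
multiplicative monoid `ℕ` (zero included), and the structure sheaf -/

/-- The group `H(p)` of fractions whose denominator is a power of `p`. -/
def fractionGroup (p : ℕ) : AddSubgroup ℚ where
  carrier := {x | ∃ (k : ℕ) (m : ℤ), x * (p : ℚ) ^ k = m}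
  zero_mem' := ⟨0, 0, by simp⟩
  add_mem' := by
    rintro x y ⟨k, m, h⟩ ⟨l, n, h'⟩
    refine ⟨k + l, m * (p : ℤ) ^ l + n * (p : ℤ) ^ k, ?_⟩
    push_cast
    rw [← h, ← h', pow_add]; ring
  neg_mem' := by
    rintro x ⟨k, m, h⟩
    exact ⟨k, -m, by push_cast; rw [← h]; ring⟩

/-- The stalks of the sheaf `𝒮` on `Spec ℤ` which defines `Θ`: the set `H(p)⁺` of non-negative
elements of `H(p)` at the prime `p`, and `{0}` at the generic point. -/
def thetaStalk (q : PrimeSpectrum ℤ) : Set ℚ :=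
  {x | 0 ≤ x ∧ (x = 0 ∨ ∃ p : ℕ, p.Prime ∧ (p : ℤ) ∈ q.asIdeal ∧ x ∈ fractionGroup p)}

/-- The zero element of a stalk of `𝒮`. -/
def thetaZero (q : PrimeSpectrum ℤ) : thetaStalk q := ⟨0, le_refl 0, Or.inl rfl⟩

/-- The multiplicative monoid `ℕ` acts on the stalks of `𝒮` by multiplication. -/
instance thetaAction (q : PrimeSpectrum ℤ) : MulAction ℕ (thetaStalk q) where
  smul n x := ⟨n * (x : ℚ), mul_nonneg n.cast_nonneg x.2.1, by
    rcases x.2.2 with h | ⟨p, hp, hq, h⟩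
    · left; rw [h, mul_zero]
    · right
      refine ⟨p, hp, hq, ?_⟩
      rw [← nsmul_eq_mul]
      exact (fractionGroup p).nsmul_mem h n⟩
  one_smul x := Subtype.ext (show ((1 : ℕ) : ℚ) * (x : ℚ) = x by simp)
  mul_smul m n x := Subtype.ext
    (show ((m * n : ℕ) : ℚ) * (x : ℚ) = m * (n * (x : ℚ)) by push_cast; ring)

/-- A section of `𝒮` over `U` is a family of elements of the stalks, only finitely many of
which are non-zero. -/
def IsThetaSection {U : Opens (TopCat.of (PrimeSpectrum ℤ))} (c : ∀ q : U, thetaStalk q.1) :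
    Prop :=
  {q : U | (c q : ℚ) ≠ 0}.Finite

/-- The relations `n • x ⊗ y = x ⊗ n • y` of a tensor product over the multiplicative
monoid `ℕ`. -/
inductive MonoidTensor.Rel (A B : Type) [MulAction ℕ A] [MulAction ℕ B] : A × B → A × B → Prop
  | smul (n : ℕ) (x : A) (y : B) : Rel A B (n • x, y) (x, n • y)

/-- The tensor product of two sets with an action of the multiplicative monoid `ℕ`. -/
def MonoidTensor (A B : Type) [MulAction ℕ A] [MulAction ℕ B] : Type :=
  Quot (MonoidTensor.Rel A B)

/-- The pure tensor `x ⊗ y`. -/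
def MonoidTensor.tmul {A B : Type} [MulAction ℕ A] [MulAction ℕ B] (x : A) (y : B) :
    MonoidTensor A B :=
  Quot.mk _ (x, y)

/-- The inverse image functor `Θ^*`, applied to an object `A` of the presheaf topos of the
multiplicative monoid `ℕ` (a set with an action of `ℕ`) that carries equivariant constants and
operations. As `Θ` is given by the flat functor `𝒮`, the sheaf `Θ^* A` is associated with the
presheaf `U ↦ A ⊗ Γ(U, 𝒮)`, its stalks are `A ⊗ 𝒮_q`, and the graph of an operation is the image
of the inverse image of the graph `Γ ⊆ A × A × A`, that is, of `Γ ⊗ 𝒮_q`. -/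
def thetaInverseImage (A : Type) [MulAction ℕ A] (h : HyperStr A) :
    HyperSheaf (TopCat.of (PrimeSpectrum ℤ)) where
  stalk q := MonoidTensor A (thetaStalk q)
  sec := TopCat.PrelocalPredicate.sheafify
    { pred := fun {U} s => ∃ (x : A) (c : ∀ q : U, thetaStalk q.1), IsThetaSection c ∧
        ∀ q : U, s q = MonoidTensor.tmul x (c q)
      res := fun i _ ⟨x, c, hc, h⟩ => ⟨x, fun q => c ⟨q.1, i.le q.2⟩,
        Set.Finite.of_injOn (f := fun q => ⟨q.1, i.le q.2⟩) (fun _ hq => hq)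
          (fun _ _ _ _ e => Subtype.ext (congrArg (fun z => z.1) e)) hc,
        fun q => h ⟨q.1, i.le q.2⟩⟩ }
  str q :=
    { zero := MonoidTensor.tmul h.zero (thetaZero q)
      one := MonoidTensor.tmul h.one (thetaZero q)
      mul := fun r s t => ∃ (x y z : A) (c : thetaStalk q), h.mul x y z ∧
        MonoidTensor.tmul x c = r ∧ MonoidTensor.tmul y c = s ∧ MonoidTensor.tmul z c = t
      add := fun r s t => ∃ (x y z : A) (c : thetaStalk q), h.add x y z ∧
        MonoidTensor.tmul x c = r ∧ MonoidTensor.tmul y c = s ∧ MonoidTensor.tmul z c = t }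

/-- The set `ℤ ∪ {-∞}` underlying `ℤ_max`. (A type of its own, because the action of `0` below
fixes `-∞`.) -/
def ZMax : Type := WithBot ℤ

/-- The action of the multiplicative monoid `ℕ` on `ℤ_max` by `k • m = k m`,
`k • (-∞) = -∞`; in particular `0 • (-∞) = -∞`. -/
instance : MulAction ℕ ZMax where
  smul k x := WithBot.map (fun m : ℤ => (k : ℤ) * m) (show WithBot ℤ from x)
  one_smul x := by
    cases x using WithBot.recBotCoe with
    | bot => rfl
    | coe m => exact congrArg (fun z : ℤ => (z : WithBot ℤ)) (by simp)
  mul_smul j k x := by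
    cases x using WithBot.recBotCoe with
    | bot => rfl
    | coe m => exact congrArg (fun z : ℤ => (z : WithBot ℤ)) (by push_cast; ring)

/-- `ℤ_hmax`: the product of `ℤ_max` is the addition of `ℤ`, its zero is `-∞` and its unit is `0`.
The sum of two distinct elements is their maximum, and `x + x` is the interval `[-∞, x]`. -/
def zHmax : HyperStr ZMax where
  zero := (⊥ : WithBot ℤ)
  one := (0 : WithBot ℤ)
  mul x y z := (show WithBot ℤ from z) = (show WithBot ℤ from x) + (show WithBot ℤ from y)
  add x y z :=
    ((show WithBot ℤ from x) ≠ (show WithBot ℤ from y) ∧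
      (show WithBot ℤ from z) = max (show WithBot ℤ from x) (show WithBot ℤ from y)) ∨
    ((show WithBot ℤ from x) = (show WithBot ℤ from y) ∧
      (show WithBot ℤ from z) ≤ (show WithBot ℤ from x))

/-- The canonical map `x ⊗ y ↦ x y` from a stalk of `Θ^* ℤ_max` to `ℚ ∪ {-∞}`
(with `(-∞) y = -∞` for all `y`, including `y = 0`). At the prime `p` it identifies the stalk
with `H(p)_max`. -/
def stalkValue (q : PrimeSpectrum ℤ) (t : MonoidTensor ZMax (thetaStalk q)) : WithBot ℚ :=
  Quot.lift
    (fun z : ZMax × thetaStalk q =>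
      WithBot.map (fun m : ℤ => (m : ℚ) * (z.2 : ℚ)) (show WithBot ℤ from z.1))
    (by
      rintro _ _ ⟨n, x, y⟩
      cases x using WithBot.recBotCoe with
      | bot => rfl
      | coe m =>
        refine congrArg (fun z : ℚ => (z : WithBot ℚ)) ?_
        change (((n : ℤ) * m : ℤ) : ℚ) * (y : ℚ) = (m : ℚ) * ((n : ℚ) * (y : ℚ))
        push_cast; ring)
    t

/-! ### Cyclotomic integers and normalized valuations -/

/-- The field `ℚ^cyc` generated by all roots of unity. -/
abbrev Qcyc : Type :=
  IntermediateField.adjoin ℚ {z : ℂ | ∃ n : ℕ, 0 < n ∧ z ^ n = 1}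

/-- The ring of cyclotomic integers, that is, the ring of integers of `ℚ^cyc`. -/
abbrev Ocyc : Type := NumberField.RingOfIntegers Qcyc

instance : Algebra.IsAlgebraic ℚ Qcyc :=
  IntermediateField.isAlgebraic_adjoin fun _ ⟨_, hn, hz⟩ =>
    IsIntegral.of_pow hn (hz ▸ isIntegral_one)

instance : IsFractionRing Ocyc Qcyc :=
  have : Algebra.IsAlgebraic ℤ Qcyc :=
    (IsFractionRing.comap_isAlgebraic_iff (A := ℤ) (K := ℚ) (C := Qcyc)).mpr inferInstance
  IsIntegralClosure.isFractionRing_of_algebraic ℤ Ocyc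
    fun _ hx => (FaithfulSMul.algebraMap_eq_zero_iff ℤ Qcyc).mp hx

/-- The morphism `π : Spec 𝒪^cyc ⟶ Spec ℤ`, on the underlying spaces. -/
noncomputable def specMap : TopCat.of (PrimeSpectrum Ocyc) ⟶ TopCat.of (PrimeSpectrum ℤ) :=
  TopCat.ofHom ⟨PrimeSpectrum.comap (algebraMap ℤ Ocyc), PrimeSpectrum.continuous_comap _⟩

/-- `v` is the valuation of `ℚ^cyc` whose valuation ring is the local ring at `℘`, normalized by
`v p = p - 1`, where `p` is the residue characteristic of `℘`. -/
structure IsNormalizedValuation (p : ℕ) (P : PrimeSpectrum Ocyc)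
    (v : AddValuation Qcyc (WithTop ℚ)) : Prop where
  nonneg_iff : ∀ f : Qcyc, 0 ≤ v f ↔ f ∈ localRing Ocyc Qcyc P
  map_prime : v (p : Qcyc) = (((p : ℚ) - 1 : ℚ) : WithTop ℚ)

/-- The map `r ↦ -r` from `ℚ ∪ {+∞}` to `ℚ ∪ {-∞}`. -/
def negValue (r : WithTop ℚ) : WithBot ℚ :=
  WithTop.recTopCoe (C := fun _ => WithBot ℚ) ⊥ (fun a : ℚ => ((-a : ℚ) : WithBot ℚ)) r

/-- The sheaf of hyperrings `(Θ ∘ π)^* 𝒪_h = π^* Θ^* 𝒪_h` on `Spec 𝒪^cyc`. -/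
noncomputable def pullbackStructureSheaf : HyperSheaf (TopCat.of (PrimeSpectrum Ocyc)) :=
  (thetaInverseImage ZMax zHmax).inverseImage specMap

/-! At every point of `Spec 𝒪^cyc` both stalks are identified with the same set, namely `H(p) ∪
{-∞}` above `p` and `{0, -∞}` at the generic point. In both, the product becomes addition of values,
and `z ∈ x + y` means that the maximum of the three values is attained at least twice
(`HyperStr.IsTropical`). This description implies the hyperring axioms and yields the bijections of
stalks.

Values. An element `f ≠ 0` of `ℚ^cyc` lies in some `ℚ(ζ_n)` with `n = p^(k+1) m` and `p ∤ m`, where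
the ramification index above `p` is `p^k (p-1)`. Hence `f^(p^k (p-1))` is a power `p^a` up to a
local unit, and `v p = p - 1` forces `v f = a / p^k`. All of `H(p)` occurs, since `ζ - 1` has value
`p^(-k)` for `ζ` of order `p^(k+1)`.

Cartier stalks. Values of sums satisfy the ultrametric inequality. Conversely, when all three values
are equal, a decomposition `h = u h + (1 - u) h` with `u` and `1 - u` local units is needed; `u =
-ζ₃` works at every point (`exists_isLocalUnit_one_sub`).

Stalks of `Θ^* 𝒪_h`. Any three elements of `H(p)` are integral multiples of one `p^(-N)`, so germs
and operations can be compared over a single second tensor factor (`exists_stalkTmul_eq₃`).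

Sections. In both sheaves germs that agree at a point agree nearby (`GermExt`), so it suffices that
each germ has one local section going to a section. A power of `ζ - 1` has a constant value above
`p` and value zero elsewhere; it matches a pure tensor supported at `p`.

Uniqueness. At closed points the value determines the germ. At the generic point the only germs are
`0` and `1`, which any isomorphism of sheaves of hyperrings preserves. -/

/-! ### Local rings of `Spec R` -/

section LocalRing

variable {R K : Type} [CommRing R] [Field K] [Algebra R K]

variable (R K) in
/-- The local ring of `Spec R` at `x` as a subring of `K`. -/
def localSubring (x : PrimeSpectrum R) : Subring K where
  carrier := localRing R K x
  one_mem' := ⟨1, 1, (Ideal.ne_top_iff_one _).mp x.isPrime.ne_top, by simp⟩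
  zero_mem' := ⟨0, 1, (Ideal.ne_top_iff_one _).mp x.isPrime.ne_top, by simp⟩
  mul_mem' := by
    rintro f g ⟨a, b, hb, h⟩ ⟨a', b', hb', h'⟩
    refine ⟨a * a', b * b', fun hm => (x.isPrime.mem_or_mem hm).elim hb hb', ?_⟩
    rw [map_mul, map_mul, ← h, ← h']; ring
  add_mem' := by
    rintro f g ⟨a, b, hb, h⟩ ⟨a', b', hb', h'⟩
    refine ⟨a * b' + a' * b, b * b', fun hm => (x.isPrime.mem_or_mem hm).elim hb hb', ?_⟩
    rw [map_mul, map_add, map_mul, map_mul, ← h, ← h']; ring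
  neg_mem' := by
    rintro f ⟨a, b, hb, h⟩
    exact ⟨-a, b, hb, by rw [map_neg, ← h]; ring⟩

theorem algebraMap_mem_localRing (x : PrimeSpectrum R) (a : R) :
    algebraMap R K a ∈ localRing R K x :=
  ⟨a, 1, (Ideal.ne_top_iff_one _).mp x.isPrime.ne_top, by simp⟩

variable (R) in
/-- The non-zero element `f` of `K` is a unit of the local ring at `x`. -/
def IsLocalUnit (x : PrimeSpectrum R) (f : K) : Prop :=
  f ≠ 0 ∧ f ∈ localSubring R K x ∧ f⁻¹ ∈ localSubring R K x

namespace IsLocalUnit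

variable {x : PrimeSpectrum R} {f g : K}

theorem one : IsLocalUnit R x (1 : K) := by
  refine ⟨one_ne_zero, one_mem _, ?_⟩
  rw [inv_one]; exact one_mem _

theorem mul (hf : IsLocalUnit R x f) (hg : IsLocalUnit R x g) : IsLocalUnit R x (f * g) := by
  refine ⟨mul_ne_zero hf.1 hg.1, mul_mem hf.2.1 hg.2.1, ?_⟩
  rw [mul_inv]; exact mul_mem hf.2.2 hg.2.2

theorem inv (hf : IsLocalUnit R x f) : IsLocalUnit R x f⁻¹ :=
  ⟨inv_ne_zero hf.1, hf.2.2, by rw [inv_inv]; exact hf.2.1⟩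

theorem pow (hf : IsLocalUnit R x f) (n : ℕ) : IsLocalUnit R x (f ^ n) := by
  induction n with
  | zero => rw [pow_zero]; exact one
  | succ n ih => rw [pow_succ]; exact ih.mul hf

theorem zpow (hf : IsLocalUnit R x f) (n : ℤ) : IsLocalUnit R x (f ^ n) := by
  cases n with
  | ofNat n => simpa using hf.pow n
  | negSucc n => rw [zpow_negSucc]; exact (hf.pow _).inv

theorem neg (hf : IsLocalUnit R x f) : IsLocalUnit R x (-f) := by
  refine ⟨neg_ne_zero.mpr hf.1, neg_mem hf.2.1, ?_⟩
  rw [inv_neg]; exact neg_mem hf.2.2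

theorem of_notMem [IsDomain R] [IsFractionRing R K] {a : R} (ha : a ∉ x.asIdeal) : IsLocalUnit R x (algebraMap R K a) := by
  have h0 : algebraMap R K a ≠ 0 := by
    rw [Ne, FaithfulSMul.algebraMap_eq_zero_iff]
    rintro rfl
    exact ha (zero_mem _)
  exact ⟨h0, algebraMap_mem_localRing x a, 1, a, ha, by rw [inv_mul_cancel₀ h0, map_one]⟩

theorem of_isUnit [IsDomain R] [IsFractionRing R K] {a : R} (ha : IsUnit a) : IsLocalUnit R x (algebraMap R K a) :=
  of_notMem fun h => x.isPrime.ne_top (Ideal.eq_top_of_isUnit_mem _ h ha)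

/-- The inverse of `f` is `f ^ (n - 1)` times the inverse of `f ^ n`. -/
theorem of_pow_mem_of_pow {n : ℕ} (hn : n ≠ 0) (h : IsLocalUnit R x (f ^ n))
    (hf : f ∈ localRing R K x) : IsLocalUnit R x f := by
  have h0 : f ≠ 0 := fun e => h.1 (by rw [e, zero_pow hn])
  refine ⟨h0, hf, ?_⟩
  obtain ⟨m, rfl⟩ := Nat.exists_eq_succ_of_ne_zero hn
  have : f⁻¹ = f ^ m * (f ^ (m + 1))⁻¹ := by
    rw [pow_succ]; field_simp
  rw [this]
  exact mul_mem (pow_mem (show f ∈ localSubring R K x from hf) m) h.2.2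

/-- Being a unit of the local ring is an open condition. -/
theorem exists_nhds (hf : IsLocalUnit R x f) :
    ∃ U : Opens (TopCat.of (PrimeSpectrum R)), x ∈ U ∧ ∀ y ∈ U, IsLocalUnit R y f := by
  obtain ⟨h0, ⟨a, b, hb, h⟩, ⟨a', b', hb', h'⟩⟩ := hf
  refine ⟨PrimeSpectrum.basicOpen (b * b'), ?_, fun y hy => ?_⟩
  · exact fun hm => (x.isPrime.mem_or_mem hm).elim hb hb'
  · have hy' : b * b' ∉ y.asIdeal := hy
    exact ⟨h0, ⟨a, b, fun hm => hy' (Ideal.mul_mem_right _ _ hm), h⟩,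
      ⟨a', b', fun hm => hy' (Ideal.mul_mem_left _ _ hm), h'⟩⟩

end IsLocalUnit

/-- The local ring at the generic point is all of `K`, so the Cartier stalk there consists of the
classes of `0` and `1`. -/
theorem isLocalUnit_of_asIdeal_eq_bot [IsDomain R] [IsFractionRing R K] {x : PrimeSpectrum R} (hx : x.asIdeal = ⊥) {f : K}
    (hf : f ≠ 0) : IsLocalUnit R x f := by
  have key : ∀ g : K, g ∈ localSubring R K x := by
    intro g
    obtain ⟨a, b, hb, rfl⟩ := IsFractionRing.div_surjective (A := R) g
    refine ⟨a, b, ?_, ?_⟩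
    · rw [hx, Ideal.mem_bot]; exact nonZeroDivisors.ne_zero hb
    · have : algebraMap R K b ≠ 0 := by
        rw [Ne, FaithfulSMul.algebraMap_eq_zero_iff]; exact nonZeroDivisors.ne_zero hb
      field_simp
  exact ⟨hf, key _, key _⟩

theorem not_isLocalUnit_of_mem [IsFractionRing R K] {x : PrimeSpectrum R} {a : R} (ha : a ∈ x.asIdeal) :
    ¬ IsLocalUnit R x (algebraMap R K a) := by
  rintro ⟨h0, -, c, d, hd, h⟩
  apply hd
  have : d = a * c := by
    apply FaithfulSMul.algebraMap_injective R K
    rw [map_mul, ← h, mul_inv_cancel_left₀ h0]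
  rw [this]
  exact Ideal.mul_mem_right _ _ ha

theorem mk_eq_mk_iff {x : PrimeSpectrum R} {f g : K} :
    UnitQuotient.mk (localUnits R K x) f = UnitQuotient.mk (localUnits R K x) g ↔
      ∃ u, IsLocalUnit R x u ∧ f = u * g := by
  rw [UnitQuotient.mk, UnitQuotient.mk, Quotient.eq, MulAction.orbitRel_apply,
    MulAction.mem_orbit_iff]
  constructor
  · rintro ⟨⟨u, hu⟩, h⟩
    exact ⟨u, ⟨u.ne_zero, hu.1, by rw [← Units.val_inv_eq_inv_val]; exact hu.2⟩, h.symm⟩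
  · rintro ⟨u, hu, h⟩
    exact ⟨⟨Units.mk0 u hu.1, hu.2.1, by rw [Units.val_inv_eq_inv_val]; exact hu.2.2⟩, h.symm⟩

end LocalRing

/-! ### Cyclotomic fields inside `ℚ^cyc` -/

open NumberField

/-- The standard primitive `n`-th root of unity in `ℚ^cyc`. -/
noncomputable def zetaCyc (n : ℕ) [NeZero n] : Qcyc :=
  ⟨Complex.exp (2 * Real.pi * Complex.I / n), IntermediateField.subset_adjoin _ _
    ⟨n, NeZero.pos n, (Complex.isPrimitiveRoot_exp n (NeZero.ne n)).pow_eq_one⟩⟩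

theorem isPrimitiveRoot_zetaCyc (n : ℕ) [NeZero n] : IsPrimitiveRoot (zetaCyc n) n :=
  IsPrimitiveRoot.of_map_of_injective (f := algebraMap Qcyc ℂ)
    (Complex.isPrimitiveRoot_exp n (NeZero.ne n)) (algebraMap Qcyc ℂ).injective

open IntermediateField in
theorem adjoin_zetaCyc_le {m n : ℕ} [NeZero m] [NeZero n] (h : m ∣ n) :
    ℚ⟮zetaCyc m⟯ ≤ ℚ⟮zetaCyc n⟯ := by
  rw [adjoin_simple_le_iff]
  obtain ⟨i, -, hi⟩ := (isPrimitiveRoot_zetaCyc n).eq_pow_of_pow_eq_one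
    (ξ := zetaCyc m) (by
      obtain ⟨c, rfl⟩ := h
      rw [pow_mul, (isPrimitiveRoot_zetaCyc m).pow_eq_one, one_pow])
  rw [← hi]
  exact pow_mem (mem_adjoin_simple_self ℚ _) i

open IntermediateField in
theorem exists_mem_adjoin_zetaCyc (f : Qcyc) : ∃ (n : ℕ) (_ : NeZero n), f ∈ ℚ⟮zetaCyc n⟯ := by
  obtain ⟨z, hz⟩ := f
  induction hz using IntermediateField.adjoin_induction with
  | mem x hx =>
    obtain ⟨n, hn, h⟩ := hx
    have : NeZero n := ⟨hn.ne'⟩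
    refine ⟨n, this, ?_⟩
    obtain ⟨i, -, hi⟩ := (isPrimitiveRoot_zetaCyc n).eq_pow_of_pow_eq_one
      (ξ := ⟨x, IntermediateField.subset_adjoin _ _ ⟨n, hn, h⟩⟩) (Subtype.ext h)
    rw [← hi]
    exact pow_mem (mem_adjoin_simple_self ℚ _) i
  | algebraMap x => exact ⟨1, ⟨one_ne_zero⟩, _root_.algebraMap_mem ℚ⟮zetaCyc 1⟯ x⟩
  | add x y hx hy h₁ h₂ =>
    obtain ⟨m, hm, h₁⟩ := h₁
    obtain ⟨n, hn, h₂⟩ := h₂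
    exact ⟨m * n, inferInstance, add_mem (adjoin_zetaCyc_le (Dvd.intro _ rfl) h₁)
      (adjoin_zetaCyc_le (Dvd.intro_left _ rfl) h₂)⟩
  | inv x hx h => exact h.imp fun n ⟨hn, h⟩ => ⟨hn, inv_mem h⟩
  | mul x y hx hy h₁ h₂ =>
    obtain ⟨m, hm, h₁⟩ := h₁
    obtain ⟨n, hn, h₂⟩ := h₂
    exact ⟨m * n, inferInstance, mul_mem (adjoin_zetaCyc_le (Dvd.intro _ rfl) h₁)
      (adjoin_zetaCyc_le (Dvd.intro_left _ rfl) h₂)⟩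

-- Replacing `n` by `p * n` makes the exponent of `p` positive, so that the ramification index has
-- the uniform shape `p ^ k * (p - 1)`.
open IntermediateField in
theorem exists_mem_adjoin_zetaCyc_prime_pow_mul {p : ℕ} (hp : p.Prime) (f : Qcyc) :
    ∃ (n m k : ℕ) (_ : NeZero n), n = p ^ (k + 1) * m ∧ ¬ p ∣ m ∧ f ∈ ℚ⟮zetaCyc n⟯ := by
  obtain ⟨n, hn, hf⟩ := exists_mem_adjoin_zetaCyc f
  have : NeZero p := ⟨hp.ne_zero⟩
  obtain ⟨k, m, hm, h⟩ := Nat.exists_eq_pow_mul_and_not_dvd (n := p * n) (NeZero.ne _) p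
    hp.ne_one
  obtain _ | k := k
  · exact absurd (Dvd.intro _ (by rw [h, pow_zero, one_mul])) hm
  · exact ⟨p * n, m, k, inferInstance, h, hm, adjoin_zetaCyc_le (Dvd.intro_left _ rfl) hf⟩

/-! ### Ramification at finite level -/

section NumberField

variable {F : Type} [Field F] [NumberField F] [Algebra F Qcyc]

/-- A `w`-integral element is a fraction with denominator outside `w`; as `w` is the contraction of
`P`, the denominator stays outside `P`. -/
theorem algebraMap_mem_localRing_of_valuation_le_one (P : PrimeSpectrum Ocyc)
    (w : IsDedekindDomain.HeightOneSpectrum (𝓞 F))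
    (hw : w.asIdeal = P.asIdeal.comap (algebraMap (𝓞 F) Ocyc)) {f : F}
    (hf : w.valuation F f ≤ 1) : algebraMap F Qcyc f ∈ localRing Ocyc Qcyc P := by
  obtain ⟨n, ⟨d, hd⟩, h⟩ := w.exists_primeCompl_mul_eq_of_integer f hf
  refine ⟨algebraMap (𝓞 F) Ocyc n, algebraMap (𝓞 F) Ocyc d, fun hm => hd ?_, ?_⟩
  · rw [hw]; exact hm
  · exact (map_mul (algebraMap F Qcyc) _ _).symm.trans (congrArg _ h)

/-- If `f` has `w`-adic order `a` and `e = p ^ k * (p - 1)` is the ramification index, which is the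
order of `p`, then `f ^ e` and `p ^ a` both have order `e a`. The second part says that the `w`-adic
valuation ring is one. -/
theorem exists_pow_eq_zpow_mul_localUnit_of_numberField {n m k p : ℕ} (hp : p.Prime)
    [IsCyclotomicExtension {n} ℚ F] (hn : n = p ^ (k + 1) * m) (hm : ¬ p ∣ m)
    (P : PrimeSpectrum Ocyc) (hP : (p : Ocyc) ∈ P.asIdeal) {f : F} (hf : f ≠ 0) :
    (∃ (a : ℤ) (u : Qcyc), IsLocalUnit Ocyc P u ∧
      algebraMap F Qcyc f ^ (p ^ k * (p - 1)) = (p : Qcyc) ^ a * u) ∧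
    (algebraMap F Qcyc f ∈ localRing Ocyc Qcyc P ∨
      (algebraMap F Qcyc f)⁻¹ ∈ localRing Ocyc Qcyc P) := by
  have := Fact.mk hp
  set Q : Ideal (𝓞 F) := P.asIdeal.comap (algebraMap (𝓞 F) Ocyc) with hQ
  have hpQ : (p : 𝓞 F) ∈ Q := by rw [hQ, Ideal.mem_comap, map_natCast]; exact hP
  have hp0 : (p : 𝓞 F) ≠ 0 := Nat.cast_ne_zero.mpr hp.ne_zero
  have hQp : Q.IsPrime := Ideal.comap_isPrime _ _
  let w : IsDedekindDomain.HeightOneSpectrum (𝓞 F) :=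
    ⟨Q, hQp, fun h => hp0 (by rw [h] at hpQ; exact hpQ)⟩
  have hpZ : Prime (p : ℤ) := Nat.prime_iff_prime_int.mp hp
  let v : IsDedekindDomain.HeightOneSpectrum ℤ :=
    ⟨Ideal.span {(p : ℤ)}, (Ideal.span_singleton_prime hpZ.ne_zero).mpr hpZ, by
      rw [Ne, Ideal.span_singleton_eq_bot]; exact hpZ.ne_zero⟩
  have hover : Q.LiesOver (Ideal.span {(p : ℤ)}) := by
    refine ⟨?_⟩
    have hmax : (Ideal.span {(p : ℤ)}).IsMaximal :=
      PrincipalIdealRing.isMaximal_of_irreducible hpZ.irreducible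
    refine hmax.eq_of_le (Ideal.comap_isPrime _ _).ne_top ?_
    rw [Ideal.span_singleton_le_iff_mem]
    change algebraMap ℤ (𝓞 F) (p : ℤ) ∈ Q
    rwa [map_natCast]
  have hover' : w.asIdeal.LiesOver v.asIdeal := hover
  have he : v.asIdeal.ramificationIdx' w.asIdeal = p ^ k * (p - 1) := by
    rw [Ideal.ramificationIdx'_eq_ramificationIdx _ _ v.ne_bot]
    exact IsCyclotomicExtension.Rat.ramificationIdx_eq n F Q hn hm
  -- On `ℚ`, the valuation `w` is the `p`-adic valuation raised to the ramification index.
  have hvp : w.valuation F (p : F) = WithZero.exp (-((p ^ k * (p - 1) : ℕ) : ℤ)) := by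
    have h := IsDedekindDomain.HeightOneSpectrum.valuation_liesOver (K := ℚ) F v w (p : ℚ)
    rw [he, map_natCast (algebraMap ℚ F)] at h
    rw [← h, ← map_natCast (algebraMap ℤ ℚ) p,
      IsDedekindDomain.HeightOneSpectrum.valuation_of_algebraMap,
      IsDedekindDomain.HeightOneSpectrum.intValuation_singleton v (r := (p : ℤ)) hpZ.ne_zero rfl,
      ← WithZero.exp_nsmul]
    simp
  have hv0 : w.valuation F f ≠ 0 := (Valuation.ne_zero_iff _).mpr hf
  have hpF : (p : F) ≠ 0 := Nat.cast_ne_zero.mpr hp.ne_zero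
  obtain ⟨a, ha⟩ : ∃ a : ℤ, w.valuation F f = WithZero.exp (-a) :=
    ⟨-WithZero.log (w.valuation F f), by rw [neg_neg, WithZero.exp_log hv0]⟩
  refine ⟨?_, ?_⟩
  · set e := p ^ k * (p - 1)
    set u : F := f ^ e * ((p : F) ^ a)⁻¹ with hu
    have hvu : w.valuation F u = 1 := by
      rw [hu, map_mul, map_pow, map_inv₀, map_zpow₀, ha, hvp, ← WithZero.exp_nsmul,
        ← WithZero.exp_zsmul, ← WithZero.exp_neg, ← WithZero.exp_add, ← WithZero.exp_zero]
      congr 1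
      simp only [smul_eq_mul, nsmul_eq_mul]
      ring
    have hu0 : u ≠ 0 := mul_ne_zero (pow_ne_zero _ hf) (inv_ne_zero (zpow_ne_zero _ hpF))
    refine ⟨a, algebraMap F Qcyc u, ⟨?_, ?_, ?_⟩, ?_⟩
    · exact (map_ne_zero _).mpr hu0
    · exact algebraMap_mem_localRing_of_valuation_le_one P w hQ hvu.le
    · rw [← map_inv₀]
      refine algebraMap_mem_localRing_of_valuation_le_one P w hQ ?_
      rw [map_inv₀, hvu, inv_one]
    · rw [hu, map_mul, map_pow, map_inv₀, map_zpow₀, map_natCast, mul_comm, mul_assoc,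
        inv_mul_cancel₀ (zpow_ne_zero _ (Nat.cast_ne_zero.mpr hp.ne_zero)), mul_one]
  · rcases le_total (w.valuation F f) 1 with h | h
    · exact Or.inl (algebraMap_mem_localRing_of_valuation_le_one P w hQ h)
    · right
      rw [← map_inv₀]
      refine algebraMap_mem_localRing_of_valuation_le_one P w hQ ?_
      rw [map_inv₀]
      exact inv_le_one_of_one_le₀ h

end NumberField

-- Dedekind theory applies only at finite level, as `𝒪^cyc` is not Noetherian; each single element
-- lives at such a level.
open IntermediateField in
theorem exists_pow_eq_zpow_mul_localUnit {p : ℕ} (hp : p.Prime) (P : PrimeSpectrum Ocyc)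
    (hP : (p : Ocyc) ∈ P.asIdeal) {f : Qcyc} (hf : f ≠ 0) :
    (∃ (k : ℕ) (a : ℤ) (u : Qcyc), IsLocalUnit Ocyc P u ∧
      f ^ (p ^ k * (p - 1)) = (p : Qcyc) ^ a * u) ∧
    (f ∈ localRing Ocyc Qcyc P ∨ f⁻¹ ∈ localRing Ocyc Qcyc P) := by
  obtain ⟨n, m, k, hn, h, hm, hF⟩ := exists_mem_adjoin_zetaCyc_prime_pow_mul hp f
  have hc : IsCyclotomicExtension {n} ℚ ℚ⟮zetaCyc n⟯ :=
    (isPrimitiveRoot_zetaCyc n).intermediateField_adjoin_isCyclotomicExtension ℚ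
  have : NumberField ℚ⟮zetaCyc n⟯ := IsCyclotomicExtension.numberField {n} ℚ _
  obtain ⟨h₁, h₂⟩ := exists_pow_eq_zpow_mul_localUnit_of_numberField hp h hm P hP
    (f := (⟨f, hF⟩ : ℚ⟮zetaCyc n⟯)) (fun e => hf (congrArg Subtype.val e))
  exact ⟨⟨k, h₁⟩, h₂⟩

open IntermediateField in
/-- The prime `p` is, up to a unit of `𝒪^cyc`, a power of `ζ - 1` for a root of unity `ζ`
of `p`-power order. -/
theorem exists_pow_mul_unit_eq_prime {p : ℕ} (hp : p.Prime) (k : ℕ) :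
    ∃ (z u : Ocyc), IsUnit u ∧ z ^ (p ^ k * (p - 1)) * u = p := by
  have := Fact.mk hp
  have : NeZero (p ^ (k + 1)) := ⟨pow_ne_zero _ hp.ne_zero⟩
  set n := p ^ (k + 1) with hn
  have hc : IsCyclotomicExtension {p ^ (k + 1)} ℚ ℚ⟮zetaCyc n⟯ :=
    (isPrimitiveRoot_zetaCyc n).intermediateField_adjoin_isCyclotomicExtension ℚ
  have : NumberField ℚ⟮zetaCyc n⟯ := IsCyclotomicExtension.numberField {p ^ (k + 1)} ℚ _
  have hz := IsCyclotomicExtension.zeta_spec (p ^ (k + 1)) ℚ ℚ⟮zetaCyc n⟯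
  -- Total ramification: `(p)` is the power of `(ζ - 1)` whose exponent is the degree of the field,
  -- and generators of the same principal ideal differ by a unit.
  have h := IsCyclotomicExtension.Rat.map_eq_span_zeta_sub_one_pow p k hz
  rw [Ideal.map_span, Set.image_singleton, Ideal.span_singleton_pow, map_natCast,
    Ideal.span_singleton_eq_span_singleton, IsCyclotomicExtension.Rat.finrank (p ^ (k + 1)),
    Nat.totient_prime_pow_succ hp] at h
  obtain ⟨u, hu⟩ := h.symm
  let g := algebraMap (𝓞 ℚ⟮zetaCyc n⟯) Ocyc
  refine ⟨g (hz.toInteger - 1), g u, u.isUnit.map g, ?_⟩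
  rw [← map_pow, ← map_mul, hu, map_natCast]

/-! ### Normalized valuations of `ℚ^cyc` -/

theorem AddValuation.exists_rat_eq {K : Type} [Field K] (v : AddValuation K (WithTop ℚ)) {f : K}
    (hf : f ≠ 0) : ∃ r : ℚ, v f = r :=
  (WithTop.ne_top_iff_exists.mp (v.ne_top_iff.mpr hf)).imp fun _ h => h.symm

theorem AddValuation.eq_zero_iff_isLocalUnit {R K : Type} [CommRing R] [Field K] [Algebra R K]
    {v : AddValuation K (WithTop ℚ)} {x : PrimeSpectrum R}
    (hv : ∀ f, 0 ≤ v f ↔ f ∈ localRing R K x) {f : K} : v f = 0 ↔ IsLocalUnit R x f := by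
  constructor
  · intro h
    have h0 : f ≠ 0 := by
      rintro rfl
      rw [v.map_zero] at h
      exact WithTop.top_ne_zero h
    refine ⟨h0, (hv _).mp h.ge, (hv _).mp ?_⟩
    rw [v.map_inv, h, neg_zero]
  · rintro ⟨h0, h1, h2⟩
    obtain ⟨r, hr⟩ := v.exists_rat_eq h0
    obtain ⟨s, hs⟩ := v.exists_rat_eq (inv_ne_zero h0)
    have h3 := (hv _).mpr h1
    have h4 := (hv _).mpr h2
    have h5 : v (f * f⁻¹) = 0 := by rw [mul_inv_cancel₀ h0, v.map_one]
    rw [v.map_mul, hr, hs] at h5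
    rw [hr] at h3
    rw [hs] at h4
    rw [hr]
    norm_cast at *
    linarith

theorem AddValuation.map_zpow_of_eq {K : Type} [Field K] {v : AddValuation K (WithTop ℚ)}
    {f : K} {r : ℚ} (hf : v f = r) (n : ℤ) : v (f ^ n) = ((n * r : ℚ) : WithTop ℚ) := by
  have key : ∀ m : ℕ, v (f ^ m) = ((m * r : ℚ) : WithTop ℚ) := by
    intro m
    rw [v.map_pow, hf, ← nsmul_eq_mul]
    exact (WithTop.coe_nsmul r m).symm
  cases n with
  | ofNat m => simpa using key m
  | negSucc m =>
    rw [zpow_negSucc, v.map_inv, key, ← WithTop.LinearOrderedAddCommGroup.coe_neg]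
    congr 1
    push_cast
    ring

/-- If a positive power of `p` were a local unit, so would be `p`, which lies in the prime ideal.
This is what makes orders well defined. -/
theorem prime_zpow_isLocalUnit_iff {p : ℕ} {P : PrimeSpectrum Ocyc}
    (hP : (p : Ocyc) ∈ P.asIdeal) {n : ℤ} : IsLocalUnit Ocyc P ((p : Qcyc) ^ n) ↔ n = 0 := by
  refine ⟨fun h => ?_, fun h => by rw [h, zpow_zero]; exact .one⟩
  have key : ∀ m : ℕ, IsLocalUnit Ocyc P ((p : Qcyc) ^ m) → m = 0 := by
    intro m hm
    by_contra h0
    refine not_isLocalUnit_of_mem (K := Qcyc) hP ?_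
    rw [map_natCast]
    exact hm.of_pow_mem_of_pow h0 (by
      rw [← map_natCast (algebraMap Ocyc Qcyc)]; exact algebraMap_mem_localRing P _)
  cases n with
  | ofNat m => simpa using key m (by simpa using h)
  | negSucc m =>
    rw [zpow_negSucc] at h
    have := h.inv
    rw [inv_inv] at this
    exact absurd (key _ this) (Nat.succ_ne_zero m)

/-- A power of `f` is a power of `p` up to a local unit, so that a valuation with value
`p - 1` at `p` has the value `r` at `f`. -/
def HasOrder (p : ℕ) (P : PrimeSpectrum Ocyc) (f : Qcyc) (r : ℚ) : Prop :=
  ∃ (e : ℕ) (a : ℤ) (u : Qcyc), e ≠ 0 ∧ IsLocalUnit Ocyc P u ∧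
    f ^ e = (p : Qcyc) ^ a * u ∧ e * r = a * ((p : ℚ) - 1)

/-! ### The order function at a prime above `p` -/

namespace HasOrder

variable {p : ℕ} {P : PrimeSpectrum Ocyc} {f g : Qcyc} {r s : ℚ}

theorem exists_of_ne_zero (hp : p.Prime) (hP : (p : Ocyc) ∈ P.asIdeal) (hf : f ≠ 0) :
    ∃ r, HasOrder p P f r := by
  obtain ⟨k, a, u, hu, h⟩ := (exists_pow_eq_zpow_mul_localUnit hp P hP hf).1
  have he : p ^ k * (p - 1) ≠ 0 :=
    mul_ne_zero (pow_ne_zero _ hp.ne_zero) (Nat.sub_ne_zero_of_lt hp.one_lt)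
  refine ⟨a * ((p : ℚ) - 1) / (p ^ k * (p - 1) : ℕ), _, a, u, he, hu, h, ?_⟩
  have : ((p ^ k * (p - 1) : ℕ) : ℚ) ≠ 0 := Nat.cast_ne_zero.mpr he
  field_simp

theorem mul (hp : p.Prime) (hf : HasOrder p P f r) (hg : HasOrder p P g s) :
    HasOrder p P (f * g) (r + s) := by
  obtain ⟨e, a, u, he, hu, h, hr⟩ := hf
  obtain ⟨e', a', u', he', hu', h', hs⟩ := hg
  have hp0 : (p : Qcyc) ≠ 0 := Nat.cast_ne_zero.mpr hp.ne_zero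
  refine ⟨e * e', a * e' + a' * e, u ^ e' * u' ^ e, mul_ne_zero he he',
    (hu.pow _).mul (hu'.pow _), ?_, ?_⟩
  · rw [mul_pow, pow_mul, h, mul_comm e e', pow_mul, h', zpow_add₀ hp0, zpow_mul, zpow_mul,
      zpow_natCast, zpow_natCast, mul_pow, mul_pow]
    ring
  · push_cast
    linear_combination (e' : ℚ) * hr + (e : ℚ) * hs

theorem inv (hf : HasOrder p P f r) : HasOrder p P f⁻¹ (-r) := by
  obtain ⟨e, a, u, he, hu, h, hr⟩ := hf
  refine ⟨e, -a, u⁻¹, he, hu.inv, ?_, ?_⟩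
  · rw [inv_pow, h, mul_inv, zpow_neg]
  · push_cast
    linear_combination -hr

/-- Order zero means `a = 0`, so `f ^ e` is a unit; since `f` or `f⁻¹` is in the local ring, `f` is
a unit itself. -/
theorem isLocalUnit_of_zero (hp : p.Prime) (hP : (p : Ocyc) ∈ P.asIdeal)
    (hf : HasOrder p P f 0) : IsLocalUnit Ocyc P f := by
  obtain ⟨e, a, u, he, hu, h, hr⟩ := hf
  have hp1 : (p : ℚ) - 1 ≠ 0 := sub_ne_zero.mpr (by exact_mod_cast hp.one_lt.ne')
  have ha : a = 0 := by
    have : (a : ℚ) = 0 := by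
      rw [mul_zero] at hr
      exact (mul_eq_zero.mp hr.symm).resolve_right hp1
    exact_mod_cast this
  rw [ha, zpow_zero, one_mul] at h
  rw [← h] at hu
  have h0 : f ≠ 0 := fun h0 => hu.1 (by rw [h0, zero_pow he])
  rcases (exists_pow_eq_zpow_mul_localUnit hp P hP h0).2 with h' | h'
  · exact hu.of_pow_mem_of_pow he h'
  · have hu' := hu.inv
    rw [← inv_pow] at hu'
    have := (hu'.of_pow_mem_of_pow he h').inv
    rwa [inv_inv] at this

theorem one : HasOrder p P 1 0 := ⟨1, 0, 1, one_ne_zero, .one, by simp, by simp⟩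

/-- For `a < 0`, both `p ^ a = f ^ e * u⁻¹` and its inverse would be in the local ring, making `p ^
a` a unit. -/
theorem nonneg (hp : p.Prime) (hP : (p : Ocyc) ∈ P.asIdeal) (hf : HasOrder p P f r)
    (h : f ∈ localRing Ocyc Qcyc P) : 0 ≤ r := by
  obtain ⟨e, a, u, he, hu, h1, hr⟩ := hf
  have hp1 : (0 : ℚ) < (p : ℚ) - 1 := sub_pos.mpr (by exact_mod_cast hp.one_lt)
  have hp0 : (p : Qcyc) ≠ 0 := Nat.cast_ne_zero.mpr hp.ne_zero
  have he' : (0 : ℚ) < e := Nat.cast_pos.mpr (Nat.pos_of_ne_zero he)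
  have ha : 0 ≤ a := by
    by_contra! ha
    have h2 : ((p : Qcyc) ^ a) ∈ localSubring Ocyc Qcyc P := by
      have : (p : Qcyc) ^ a = f ^ e * u⁻¹ := by rw [h1, mul_inv_cancel_right₀ hu.1]
      rw [this]
      exact mul_mem (pow_mem (show f ∈ localSubring Ocyc Qcyc P from h) e) hu.2.2
    have h3 : ((p : Qcyc) ^ a)⁻¹ ∈ localSubring Ocyc Qcyc P := by
      obtain ⟨m, rfl⟩ := Int.exists_eq_neg_ofNat ha.le
      rw [zpow_neg, inv_inv, zpow_natCast]
      exact pow_mem (natCast_mem _ p) m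
    exact ha.ne ((prime_zpow_isLocalUnit_iff hP).mp ⟨zpow_ne_zero _ hp0, h2, h3⟩)
  have : 0 ≤ e * r := by rw [hr]; positivity
  exact nonneg_of_mul_nonneg_right this he'

theorem mem_of_nonneg (hp : p.Prime) (hP : (p : Ocyc) ∈ P.asIdeal) (hf : HasOrder p P f r)
    (hf0 : f ≠ 0) (h : 0 ≤ r) : f ∈ localRing Ocyc Qcyc P := by
  rcases (exists_pow_eq_zpow_mul_localUnit hp P hP hf0).2 with h' | h'
  · exact h'
  · have := hf.inv.nonneg hp hP h'
    obtain rfl : r = 0 := by linarith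
    exact (hf.isLocalUnit_of_zero hp hP).2.1

/-- The element `1 = f * f⁻¹` has both orders `r - s` and `s - r`, and it is in the local ring. -/
theorem unique (hp : p.Prime) (hP : (p : Ocyc) ∈ P.asIdeal) (hf0 : f ≠ 0)
    (hf : HasOrder p P f r) (hg : HasOrder p P f s) : r = s := by
  have key : ∀ {r s}, HasOrder p P f r → HasOrder p P f s → 0 ≤ r - s := fun h h' => by
    have := h.mul hp h'.inv
    rw [mul_inv_cancel₀ hf0] at this
    rw [sub_eq_add_neg]
    exact this.nonneg hp hP (one_mem (localSubring Ocyc Qcyc P))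
  linarith [key hf hg, key hg hf]

/-- One of `f / g` and `g / f` is in the local ring; adding `1` shows that `f + g` divided by the
respective denominator is too, hence has non-negative order. -/
theorem min_le_add {t : ℚ} (hp : p.Prime) (hP : (p : Ocyc) ∈ P.asIdeal) (hf0 : f ≠ 0)
    (hg0 : g ≠ 0) (hf : HasOrder p P f r) (hg : HasOrder p P g s)
    (hfg : HasOrder p P (f + g) t) : min r s ≤ t := by
  have key : ∀ {f g : Qcyc} {r s t : ℚ}, g ≠ 0 → HasOrder p P g s → HasOrder p P (f + g) t →
      f * g⁻¹ ∈ localRing Ocyc Qcyc P → s ≤ t := by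
    intro f g r s t hg0 hg hfg h
    have h1 := (hfg.mul hp hg.inv).nonneg hp hP (by
      rw [add_mul, mul_inv_cancel₀ hg0]
      exact (localSubring Ocyc Qcyc P).add_mem h (one_mem _))
    linarith
  rcases (exists_pow_eq_zpow_mul_localUnit hp P hP (mul_ne_zero hf0 (inv_ne_zero hg0))).2 with h | h
  · exact min_le_of_right_le (key (r := r) hg0 hg hfg h)
  · refine min_le_of_left_le (key (f := g) (r := s) hf0 hf (by rwa [add_comm]) ?_)
    rwa [mul_inv, inv_inv, mul_comm] at h

theorem prime (p : ℕ) (P : PrimeSpectrum Ocyc) : HasOrder p P (p : Qcyc) ((p : ℚ) - 1) :=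
  ⟨1, 1, 1, one_ne_zero, .one, by simp, by simp⟩

end HasOrder

theorem IsNormalizedValuation.eq_of_hasOrder {p : ℕ} {P : PrimeSpectrum Ocyc}
    {v : AddValuation Qcyc (WithTop ℚ)} (hv : IsNormalizedValuation p P v) {f : Qcyc} (hf : f ≠ 0)
    {r : ℚ} (h : HasOrder p P f r) : v f = r := by
  obtain ⟨e, a, u, he, hu, h1, hr⟩ := h
  obtain ⟨s, hs⟩ := v.exists_rat_eq hf
  have h2 := congrArg v h1
  rw [v.map_mul, ← zpow_natCast, AddValuation.map_zpow_of_eq hs,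
    AddValuation.map_zpow_of_eq hv.map_prime,
    (AddValuation.eq_zero_iff_isLocalUnit hv.nonneg_iff).mpr hu, add_zero] at h2
  have h3 : ((e : ℤ) : ℚ) * s = a * ((p : ℚ) - 1) := WithTop.coe_injective h2
  rw [Int.cast_natCast, ← hr] at h3
  rw [hs, mul_left_cancel₀ (Nat.cast_ne_zero.mpr he) h3]

/-- The order, extended by `⊤` at zero, is the valuation. It is the only one because a relation `f ^
e = p ^ a * u` determines `v f` from `v p`. -/
theorem existsUnique_isNormalizedValuation {p : ℕ} {P : PrimeSpectrum Ocyc} (hp : p.Prime)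
    (hP : (p : Ocyc) ∈ P.asIdeal) :
    ∃! v : AddValuation Qcyc (WithTop ℚ), IsNormalizedValuation p P v := by
  classical
  have hex : ∀ f : Qcyc, ∃ r : WithTop ℚ, (f = 0 → r = ⊤) ∧
      (f ≠ 0 → ∃ s : ℚ, r = s ∧ HasOrder p P f s) := by
    intro f
    by_cases hf : f = 0
    · exact ⟨⊤, fun _ => rfl, fun h => absurd hf h⟩
    · obtain ⟨s, hs⟩ := HasOrder.exists_of_ne_zero hp hP hf
      exact ⟨s, fun h => absurd h hf, fun _ => ⟨s, rfl, hs⟩⟩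
  choose w hw0 hw using hex
  have huniq : ∀ {f : Qcyc} {r : ℚ}, f ≠ 0 → HasOrder p P f r → w f = r := fun {f r} hf h => by
    obtain ⟨s, hs, h'⟩ := hw f hf
    rw [hs, h.unique hp hP hf h']
  let v : AddValuation Qcyc (WithTop ℚ) := AddValuation.of w (hw0 0 rfl)
    (huniq one_ne_zero HasOrder.one)
    (fun f g => by
      by_cases hf : f = 0
      · rw [hf, zero_add]; exact min_le_right _ _
      by_cases hg : g = 0
      · rw [hg, add_zero]; exact min_le_left _ _
      by_cases h0 : f + g = 0
      · rw [hw0 _ h0]; exact le_top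
      obtain ⟨r, hr, h₁⟩ := hw f hf
      obtain ⟨s, hs, h₂⟩ := hw g hg
      obtain ⟨t, ht, h₃⟩ := hw _ h0
      rw [hr, hs, ht, ← WithTop.coe_min]
      exact WithTop.coe_le_coe.mpr (h₁.min_le_add hp hP hf hg h₂ h₃))
    (fun f g => by
      by_cases hf : f = 0
      · rw [hw0 f hf, top_add]; exact hw0 _ (by rw [hf, zero_mul])
      by_cases hg : g = 0
      · rw [hw0 g hg, add_top]; exact hw0 _ (by rw [hg, mul_zero])
      obtain ⟨r, hr, h₁⟩ := hw f hf
      obtain ⟨s, hs, h₂⟩ := hw g hg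
      rw [hr, hs, huniq (mul_ne_zero hf hg) (h₁.mul hp h₂), WithTop.coe_add])
  refine ⟨v, ⟨fun f => ?_, ?_⟩, fun v' hv' => AddValuation.ext fun f => ?_⟩
  · change 0 ≤ w f ↔ _
    by_cases hf : f = 0
    · rw [hw0 f hf, hf]
      exact iff_of_true le_top (zero_mem (localSubring Ocyc Qcyc P))
    · obtain ⟨r, hr, h⟩ := hw f hf
      rw [hr]
      exact ⟨fun h' => h.mem_of_nonneg hp hP hf (by exact_mod_cast h'),
        fun h' => by exact_mod_cast h.nonneg hp hP h'⟩
  · exact huniq (Nat.cast_ne_zero.mpr hp.ne_zero) (HasOrder.prime p P)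
  · change v' f = w f
    by_cases hf : f = 0
    · rw [hw0 f hf, hf, v'.map_zero]
    · obtain ⟨r, hr, h⟩ := hw f hf
      rw [hr, hv'.eq_of_hasOrder hf h]

/-- The normalization `v p = p - 1` cancels the tame factor `p - 1` of the ramification index, so
that only `p ^ k` remains in the denominator. -/
theorem IsNormalizedValuation.mem_fractionGroup {p : ℕ} {P : PrimeSpectrum Ocyc} (hp : p.Prime)
    (hP : (p : Ocyc) ∈ P.asIdeal) {v : AddValuation Qcyc (WithTop ℚ)}
    (hv : IsNormalizedValuation p P v) {f : Qcyc} {r : ℚ} (h : v f = r) :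
    r ∈ fractionGroup p := by
  have hf : f ≠ 0 := by
    rintro rfl
    rw [v.map_zero] at h
    exact WithTop.top_ne_coe h
  obtain ⟨k, a, u, hu, h1⟩ := (exists_pow_eq_zpow_mul_localUnit hp P hP hf).1
  have h2 := congrArg v h1
  rw [v.map_mul, ← zpow_natCast, AddValuation.map_zpow_of_eq h,
    AddValuation.map_zpow_of_eq hv.map_prime,
    (AddValuation.eq_zero_iff_isLocalUnit hv.nonneg_iff).mpr hu, add_zero] at h2
  have h3 : (((p ^ k * (p - 1) : ℕ) : ℤ) : ℚ) * r = a * ((p : ℚ) - 1) := WithTop.coe_injective h2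
  have hp1 : (p : ℚ) - 1 ≠ 0 := sub_ne_zero.mpr (by exact_mod_cast hp.one_lt.ne')
  rw [Int.cast_natCast, Nat.cast_mul, Nat.cast_sub hp.one_lt.le, Nat.cast_pow, Nat.cast_one] at h3
  refine ⟨k, a, mul_right_cancel₀ hp1 ?_⟩
  linear_combination h3

/-- Every element of `H(p)` is the value, at all primes above `p`, of an element of `ℚ^cyc`
which is a unit at all other primes. -/
theorem exists_forall_isNormalizedValuation_eq {p : ℕ} (hp : p.Prime) {r : ℚ}
    (hr : r ∈ fractionGroup p) :
    ∃ g : Qcyc, g ≠ 0 ∧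
      (∀ (P : PrimeSpectrum Ocyc) (v : AddValuation Qcyc (WithTop ℚ)),
        IsNormalizedValuation p P v → v g = r) ∧
      ∀ P : PrimeSpectrum Ocyc, (p : Ocyc) ∉ P.asIdeal → IsLocalUnit Ocyc P g := by
  obtain ⟨k, a, ha⟩ := hr
  obtain ⟨z, u, hu, h⟩ := exists_pow_mul_unit_eq_prime hp k
  have hp0 : (p : Ocyc) ≠ 0 := Nat.cast_ne_zero.mpr hp.ne_zero
  have he : p ^ k * (p - 1) ≠ 0 :=
    mul_ne_zero (pow_ne_zero _ hp.ne_zero) (Nat.sub_ne_zero_of_lt hp.one_lt)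
  have hz : z ≠ 0 := by
    rintro rfl
    rw [zero_pow he, zero_mul] at h
    exact hp0 h.symm
  have hz' : algebraMap Ocyc Qcyc z ≠ 0 := by
    rwa [Ne, FaithfulSMul.algebraMap_eq_zero_iff]
  -- Here `r = a / p ^ k`, and `z` has value `1 / p ^ k`. Away from `p` it is a unit because it
  -- divides `p`.
  refine ⟨algebraMap Ocyc Qcyc z ^ a, zpow_ne_zero _ hz', fun P v hv => ?_, fun P hP => ?_⟩
  · obtain ⟨s, hs⟩ := v.exists_rat_eq hz'
    have h2 := congrArg (fun x => v (algebraMap Ocyc Qcyc x)) h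
    simp only [map_mul, map_pow, map_natCast, v.map_mul] at h2
    rw [hv.map_prime, (AddValuation.eq_zero_iff_isLocalUnit hv.nonneg_iff).mpr
      (IsLocalUnit.of_isUnit hu), add_zero, ← zpow_natCast, AddValuation.map_zpow_of_eq hs] at h2
    have h3 : (((p ^ k * (p - 1) : ℕ) : ℤ) : ℚ) * s = (p : ℚ) - 1 := WithTop.coe_injective h2
    have hp1 : (p : ℚ) - 1 ≠ 0 := sub_ne_zero.mpr (by exact_mod_cast hp.one_lt.ne')
    rw [Int.cast_natCast, Nat.cast_mul, Nat.cast_sub hp.one_lt.le, Nat.cast_pow, Nat.cast_one]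
      at h3
    have h4 : (p : ℚ) ^ k * s = 1 := mul_right_cancel₀ hp1 (by linear_combination h3)
    have h5 : (p : ℚ) ^ k ≠ 0 := pow_ne_zero _ (Nat.cast_ne_zero.mpr hp.ne_zero)
    rw [AddValuation.map_zpow_of_eq hs]
    congr 1
    apply mul_left_cancel₀ h5
    linear_combination (a : ℚ) * h4 - ha
  · refine (IsLocalUnit.of_notMem fun hm => hP ?_).zpow a
    rw [← h]
    exact Ideal.mul_mem_right _ _ (Ideal.pow_mem_of_mem _ hm _ (Nat.pos_of_ne_zero he))

/-! ### Hyperrings of tropical type -/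

/-- The maximum of `a`, `b`, `c` is attained at least twice. -/
def MaxTwice {α : Type} [LinearOrder α] (a b c : α) : Prop :=
  a ≤ max b c ∧ b ≤ max a c ∧ c ≤ max a b

namespace MaxTwice

variable {α β : Type} [LinearOrder α] [LinearOrder β] {a b c d : α}

/-- The hypersum of `ℤ_hmax` is thereby a relation symmetric in all three entries. -/
theorem iff_eq_max_or_le :
    MaxTwice a b c ↔ (a ≠ b ∧ c = max a b) ∨ (a = b ∧ c ≤ a) := by
  unfold MaxTwice
  rcases lt_trichotomy a b with h | rfl | h
  · simp only [max_eq_right h.le, h.ne, ne_eq, not_false_eq_true, true_and, false_and, or_false]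
    constructor
    · rintro ⟨-, h2, h3⟩
      rcases le_max_iff.mp h2 with h' | h'
      · exact absurd h h'.not_gt
      · exact le_antisymm h3 h'
    · rintro rfl
      exact ⟨le_max_of_le_left h.le, le_max_right _ _, le_rfl⟩
  · simp
  · simp only [max_eq_left h.le, h.ne', ne_eq, not_false_eq_true, true_and, false_and, or_false]
    constructor
    · rintro ⟨h2, -, h3⟩
      rcases le_max_iff.mp h2 with h' | h'
      · exact absurd h h'.not_gt
      · exact le_antisymm h3 h'
    · rintro rfl
      exact ⟨le_max_right _ _, le_max_of_le_left h.le, le_rfl⟩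

/-- Monotone maps commute with `max`. No injectivity is required, so this applies to rounding and to
scaling by zero. -/
theorem map {f : α → β} (hf : Monotone f) (h : MaxTwice a b c) :
    MaxTwice (f a) (f b) (f c) := by
  unfold MaxTwice
  rw [← hf.map_max, ← hf.map_max, ← hf.map_max]
  exact ⟨hf h.1, hf h.2.1, hf h.2.2⟩

theorem swap_left (h : MaxTwice a b c) : MaxTwice b a c :=
  ⟨h.2.1, h.1, by rw [max_comm]; exact h.2.2⟩

theorem swap_right (h : MaxTwice a b c) : MaxTwice a c b :=
  ⟨by rw [max_comm]; exact h.1, h.2.2, h.2.1⟩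

/-- The maximum of four elements is attained at least twice. -/
theorem exists_iff {V : Set α} (ha : a ∈ V) (hb : b ∈ V) (hc : c ∈ V) (hd : d ∈ V) :
    (∃ t ∈ V, MaxTwice a b t ∧ MaxTwice t c d) ↔
      a ≤ max b (max c d) ∧ b ≤ max a (max c d) ∧ c ≤ max d (max a b) ∧ d ≤ max c (max a b) := by
  unfold MaxTwice
  constructor
  · rintro ⟨t, -, h⟩
    grind
  · intro h
    -- If `a ≠ b`, then `t` must be the larger one. If `a = b`, take `t = max c d` when `c ≤ a`;
    -- otherwise `c = d > a`, and `t = a` works.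
    by_cases hab : a ≤ b
    · by_cases hba : b ≤ a
      · by_cases hca : c ≤ a
        · by_cases hdc : d ≤ c
          · exact ⟨c, hc, by grind⟩
          · exact ⟨d, hd, by grind⟩
        · exact ⟨a, ha, by grind⟩
      · exact ⟨b, hb, by grind⟩
    · exact ⟨a, ha, by grind⟩

end MaxTwice

/-- `val` identifies `h` with the hyperring `S ∪ {-∞}` whose product is the addition of `S`, and
where `z ∈ x + y` means that the maximum of `x`, `y`, `z` is attained at least twice. -/
structure HyperStr.IsTropical {A : Type} (h : HyperStr A) (S : AddSubgroup ℚ)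
    (val : A → WithBot ℚ) : Prop where
  injective : Function.Injective val
  exists_iff : ∀ t : WithBot ℚ, (∃ a, val a = t) ↔ ∀ r : ℚ, t = r → r ∈ S
  val_zero : val h.zero = ⊥
  val_one : val h.one = 0
  mul_iff : ∀ x y z, h.mul x y z ↔ val z = val x + val y
  add_iff : ∀ x y z, h.add x y z ↔ MaxTwice (val x) (val y) (val z)

namespace HyperStr.IsTropical

variable {A : Type} {h : HyperStr A} {S : AddSubgroup ℚ} {val : A → WithBot ℚ}

theorem exists_add (H : h.IsTropical S val) (x y : A) : ∃ z, val z = val x + val y := by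
  rw [H.exists_iff]
  intro r hr
  have hx := (H.exists_iff (val x)).mp ⟨x, rfl⟩
  have hy := (H.exists_iff (val y)).mp ⟨y, rfl⟩
  cases hvx : val x with
  | bot => rw [hvx, WithBot.bot_add] at hr; exact absurd hr WithBot.bot_ne_coe
  | coe a =>
    cases hvy : val y with
    | bot => rw [hvy, WithBot.add_bot] at hr; exact absurd hr WithBot.bot_ne_coe
    | coe b =>
      rw [hvx, hvy, ← WithBot.coe_add] at hr
      rw [← WithBot.coe_injective hr]
      exact S.add_mem (hx a hvx) (hy b hvy)

theorem exists_sub (H : h.IsTropical S val) (x y : A) (hx : val x ≠ ⊥) :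
    ∃ z, val y = val x + val z := by
  obtain ⟨a, ha⟩ := WithBot.ne_bot_iff_exists.mp hx
  cases hvy : val y with
  | bot => exact ⟨y, by rw [hvy, WithBot.add_bot]⟩
  | coe b =>
    obtain ⟨z, hz⟩ := (H.exists_iff ((b - a : ℚ) : WithBot ℚ)).mpr (by
      intro r hr
      rw [← WithBot.coe_injective hr]
      exact S.sub_mem ((H.exists_iff (val y)).mp ⟨y, rfl⟩ b hvy)
        ((H.exists_iff (val x)).mp ⟨x, rfl⟩ a ha.symm))
    exact ⟨z, by rw [hz, ← ha, ← WithBot.coe_add, add_sub_cancel]⟩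

theorem exists_mem_add (H : h.IsTropical S val) (x y : A) : ∃ z, h.add x y z := by
  rcases le_total (val x) (val y) with hxy | hxy
  · exact ⟨y, (H.add_iff _ _ _).mpr ⟨by simp [hxy], by simp, by simp⟩⟩
  · exact ⟨x, (H.add_iff _ _ _).mpr ⟨by simp, by simp [hxy], by simp⟩⟩

/-- Both bracketings of a triple sum say that the maximum of four values is attained twice. Every
element is its own opposite, so reversibility is the symmetry of `MaxTwice`. -/
theorem isHyperring (H : h.IsTropical S val) : h.IsHyperring where
  add_nonempty := H.exists_mem_add
  add_comm x y z hz := (H.add_iff _ _ _).mpr ((H.add_iff _ _ _).mp hz).swap_left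
  add_zero x z := by
    rw [H.add_iff, H.val_zero, MaxTwice]
    simp only [bot_le, max_eq_right, max_eq_left, true_and]
    exact ⟨fun e => H.injective (le_antisymm e.2 e.1), fun e => e ▸ ⟨le_rfl, le_rfl⟩⟩
  add_assoc x y z w := by
    have key : ∀ x y z w : A, (∃ t, h.add x y t ∧ h.add t z w) ↔
        ∃ t ∈ Set.range val, MaxTwice (val x) (val y) t ∧ MaxTwice t (val z) (val w) := by
      intro x y z w
      simp only [H.add_iff, Set.exists_range_iff]
    have key' : (∃ t, h.add y z t ∧ h.add x t w) ↔ ∃ t, h.add y z t ∧ h.add t x w :=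
      exists_congr fun t => and_congr_right fun _ => by
        rw [H.add_iff, H.add_iff]; exact ⟨MaxTwice.swap_left, MaxTwice.swap_left⟩
    have hV : ∀ a, val a ∈ Set.range val := Set.mem_range_self
    rw [key', key, key, MaxTwice.exists_iff (hV x) (hV y) (hV z) (hV w),
      MaxTwice.exists_iff (hV y) (hV z) (hV x) (hV w)]
    grind
  exists_unique_neg x := by
    refine ⟨x, (H.add_iff _ _ _).mpr (by rw [H.val_zero]; simp [MaxTwice]), fun y hy => ?_⟩
    have := (H.add_iff _ _ _).mp hy
    rw [H.val_zero, MaxTwice] at this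
    simp only [bot_le, max_eq_left, and_true] at this
    exact H.injective (le_antisymm this.2 this.1)
  reversible x x' y z h0 hz := by
    have := (H.add_iff _ _ _).mp h0
    rw [H.val_zero, MaxTwice] at this
    simp only [bot_le, max_eq_left, and_true] at this
    obtain rfl : x = x' := H.injective (le_antisymm this.1 this.2)
    exact (H.add_iff _ _ _).mpr ((H.add_iff _ _ _).mp hz).swap_right.swap_left
  mul_existsUnique x y := by
    obtain ⟨z, hz⟩ := H.exists_add x y
    exact ⟨z, (H.mul_iff _ _ _).mpr hz,
      fun w hw => H.injective (((H.mul_iff _ _ _).mp hw).trans hz.symm)⟩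
  mul_comm x y z hz := by
    rw [H.mul_iff] at hz ⊢
    rw [hz, _root_.add_comm]
  mul_assoc x y z a b w ha hb := by
    rw [H.mul_iff] at ha hb ⊢
    rw [H.mul_iff, ha, hb, _root_.add_assoc]
  mul_one x := by rw [H.mul_iff, H.val_one, _root_.add_zero]
  mul_zero x := by rw [H.mul_iff, H.val_zero, WithBot.add_bot]
  distrib r x y a b w ha hb := by
    rw [H.mul_iff] at ha hb
    rw [H.add_iff, ha, hb]
    have hmono : Monotone fun t : WithBot ℚ => val r + t := fun _ _ h => add_le_add_right h _
    constructor
    · intro hw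
      -- For `r = 0` all products vanish and any `z ∈ x + y` will do; otherwise `w` is divided by
      -- `r` and the relation is translated back.
      by_cases hr : val r = ⊥
      · simp only [hr, WithBot.bot_add, MaxTwice, max_self, le_bot_iff] at hw
        obtain ⟨z, hz⟩ := H.exists_mem_add x y
        exact ⟨z, hz, (H.mul_iff _ _ _).mpr (by rw [hw.2.2, hr, WithBot.bot_add])⟩
      · obtain ⟨z, hz⟩ := H.exists_sub r w hr
        refine ⟨z, (H.add_iff _ _ _).mpr ?_, (H.mul_iff _ _ _).mpr hz⟩
        obtain ⟨c, hc⟩ := WithBot.ne_bot_iff_exists.mp hr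
        have := hw.map (f := fun t : WithBot ℚ => ((-c : ℚ) : WithBot ℚ) + t)
          (fun _ _ h => add_le_add_right h _)
        have hcc : ∀ t : WithBot ℚ, ((-c : ℚ) : WithBot ℚ) + (val r + t) = t := fun t => by
          rw [← hc, ← _root_.add_assoc, ← WithBot.coe_add, neg_add_cancel, WithBot.coe_zero,
            zero_add]
        rwa [hz, hcc, hcc, hcc] at this
    · rintro ⟨z, hz, hw⟩
      rw [(H.mul_iff _ _ _).mp hw]
      exact ((H.add_iff _ _ _).mp hz).map hmono
  zero_ne_one e := by
    have := congrArg val e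
    rw [H.val_zero, H.val_one] at this
    exact WithBot.bot_ne_coe this

end HyperStr.IsTropical

/-! ### The stalks of `Θ^* 𝒪_h` -/

theorem prime_eq_of_mem_asIdeal {q : PrimeSpectrum ℤ} {p p' : ℕ} (hp : p.Prime) (hp' : p'.Prime)
    (h : (p : ℤ) ∈ q.asIdeal) (h' : (p' : ℤ) ∈ q.asIdeal) : p = p' := by
  by_contra hne
  have hc := Nat.isCoprime_iff_coprime.mpr ((Nat.coprime_primes hp hp').mpr hne)
  obtain ⟨a, b, hab⟩ := hc
  refine q.isPrime.ne_top ((Ideal.eq_top_iff_one _).mpr ?_)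
  rw [← hab]
  exact add_mem (Ideal.mul_mem_left _ _ h) (Ideal.mul_mem_left _ _ h')

/-- The group of differences of elements of the stalk of `𝒮` at `q`: it is `H(p)` at the prime
`p` and zero at the generic point. -/
def valueGroup (q : PrimeSpectrum ℤ) : AddSubgroup ℚ where
  carrier := {x | x = 0 ∨ ∃ p : ℕ, p.Prime ∧ (p : ℤ) ∈ q.asIdeal ∧ x ∈ fractionGroup p}
  zero_mem' := Or.inl rfl
  add_mem' := by
    rintro x y (rfl | ⟨p, hp, hq, hx⟩) hy
    · rwa [zero_add]
    · rcases hy with rfl | ⟨p', hp', hq', hy⟩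
      · rw [add_zero]; exact Or.inr ⟨p, hp, hq, hx⟩
      · obtain rfl := prime_eq_of_mem_asIdeal hp hp' hq hq'
        exact Or.inr ⟨p, hp, hq, add_mem hx hy⟩
  neg_mem' := by
    rintro x (rfl | ⟨p, hp, hq, hx⟩)
    · exact Or.inl neg_zero
    · exact Or.inr ⟨p, hp, hq, neg_mem hx⟩

theorem mem_valueGroup_iff {q : PrimeSpectrum ℤ} {p : ℕ} (hp : p.Prime)
    (hq : (p : ℤ) ∈ q.asIdeal) {x : ℚ} : x ∈ valueGroup q ↔ x ∈ fractionGroup p := by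
  refine ⟨?_, fun h => Or.inr ⟨p, hp, hq, h⟩⟩
  rintro (rfl | ⟨p', hp', hq', h⟩)
  · exact zero_mem _
  · rwa [prime_eq_of_mem_asIdeal hp hp' hq hq']

theorem mem_valueGroup_iff_of_forall_notMem {q : PrimeSpectrum ℤ}
    (hq : ∀ p : ℕ, p.Prime → (p : ℤ) ∉ q.asIdeal) {x : ℚ} : x ∈ valueGroup q ↔ x = 0 :=
  ⟨fun h => h.resolve_right fun ⟨p, hp, h, _⟩ => hq p hp h, Or.inl⟩

/-- At `p` the reciprocal of the product of the three denominators works; at the generic point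
everything is zero. -/
theorem exists_common_divisor {q : PrimeSpectrum ℤ} {r s t : ℚ} (hr : r ∈ valueGroup q)
    (hs : s ∈ valueGroup q) (ht : t ∈ valueGroup q) :
    ∃ c : thetaStalk q, (∃ m : ℤ, r = m * (c : ℚ)) ∧ (∃ m : ℤ, s = m * (c : ℚ)) ∧
      ∃ m : ℤ, t = m * (c : ℚ) := by
  by_cases h : ∃ p : ℕ, p.Prime ∧ (p : ℤ) ∈ q.asIdeal
  · obtain ⟨p, hp, hq⟩ := h
    rw [mem_valueGroup_iff hp hq] at hr hs ht
    obtain ⟨i, a, ha⟩ := hr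
    obtain ⟨j, b, hb⟩ := hs
    obtain ⟨k, d, hd⟩ := ht
    have hp0 : (p : ℚ) ≠ 0 := Nat.cast_ne_zero.mpr hp.ne_zero
    refine ⟨⟨((p : ℚ) ^ (i + j + k))⁻¹, by positivity, Or.inr ⟨p, hp, hq, i + j + k, 1, ?_⟩⟩,
      ⟨a * p ^ (j + k), ?_⟩, ⟨b * p ^ (i + k), ?_⟩, ⟨d * p ^ (i + j), ?_⟩⟩
    · rw [inv_mul_cancel₀ (pow_ne_zero _ hp0), Int.cast_one]
    · push_cast; rw [← ha]; field_simp; ring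
    · push_cast; rw [← hb]; field_simp; ring
    · push_cast; rw [← hd]; field_simp; ring
  · have h0 : ∀ x ∈ valueGroup q, x = 0 := fun x hx =>
      (mem_valueGroup_iff_of_forall_notMem fun p hp hq => h ⟨p, hp, hq⟩).mp hx
    exact ⟨thetaZero q, ⟨0, by rw [h0 r hr]; simp⟩, ⟨0, by rw [h0 s hs]; simp⟩,
      ⟨0, by rw [h0 t ht]; simp⟩⟩

/-- Multiplication by `c`, as a map from `ℤ ∪ {-∞}` to `ℚ ∪ {-∞}`. -/
def scaleBot (c : ℚ) : WithBot ℤ → WithBot ℚ := WithBot.map fun m : ℤ => (m : ℚ) * c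

/-- The integral part of the quotient by `c`, as a map from `ℚ ∪ {-∞}` to `ℤ ∪ {-∞}`. -/
def floorBot (c : ℚ) : WithBot ℚ → WithBot ℤ := WithBot.map fun r : ℚ => ⌊r / c⌋

theorem monotone_scaleBot {c : ℚ} (hc : 0 ≤ c) : Monotone (scaleBot c) :=
  (show Monotone fun m : ℤ => (m : ℚ) * c from fun _ _ h =>
    mul_le_mul_of_nonneg_right (Int.cast_le.mpr h) hc).withBot_map

theorem monotone_floorBot {c : ℚ} (hc : 0 ≤ c) : Monotone (floorBot c) :=
  (show Monotone fun r : ℚ => ⌊r / c⌋ from fun _ _ h =>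
    Int.floor_mono (div_le_div_of_nonneg_right h hc)).withBot_map

theorem floor_mul_div (m : ℤ) {c : ℚ} (hc : c ≠ 0) : ⌊(m : ℚ) * c / c⌋ = m := by
  rw [mul_div_cancel_right₀ _ hc, Int.floor_intCast]

/-- Rounding is exact on multiples of `c`; the floor serves to have a monotone inverse of scaling
defined everywhere. For `c = 0` both sides vanish on finite values. -/
theorem scaleBot_floorBot {c : ℚ} {v : WithBot ℚ} (hv : ∀ r : ℚ, v = r → ∃ m : ℤ, r = m * c) :
    scaleBot c (floorBot c v) = v := by
  cases v with
  | bot => rfl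
  | coe r =>
    obtain ⟨m, rfl⟩ := hv r rfl
    refine congrArg (fun z : ℚ => (z : WithBot ℚ)) ?_
    by_cases hc : c = 0
    · simp [hc]
    · beta_reduce
      rw [floor_mul_div m hc]

theorem scaleBot_add (c : ℚ) (x y : WithBot ℤ) :
    scaleBot c (x + y) = scaleBot c x + scaleBot c y := by
  cases x with
  | bot => rfl
  | coe a =>
    cases y with
    | bot => rfl
    | coe b =>
      refine congrArg (fun z : ℚ => (z : WithBot ℚ)) ?_
      push_cast; ring

theorem floorBot_add {c : ℚ} {v w : WithBot ℚ} (hv : ∀ r : ℚ, v = r → ∃ m : ℤ, r = m * c)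
    (hw : ∀ r : ℚ, w = r → ∃ m : ℤ, r = m * c) :
    floorBot c (v + w) = floorBot c v + floorBot c w := by
  cases v with
  | bot => rfl
  | coe r =>
    cases w with
    | bot => rfl
    | coe s =>
      obtain ⟨m, rfl⟩ := hv r rfl
      obtain ⟨n, rfl⟩ := hw s rfl
      refine congrArg (fun z : ℤ => (z : WithBot ℤ)) ?_
      by_cases hc : c = 0
      · simp [hc]
      · beta_reduce
        rw [← add_mul, ← Int.cast_add, floor_mul_div _ hc, floor_mul_div _ hc, floor_mul_div _ hc]

section Tensor

variable {q : PrimeSpectrum ℤ}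

/-- The pure tensor `x ⊗ c` in a stalk of `Θ^* ℤ_max`. -/
def stalkTmul (x : WithBot ℤ) (c : thetaStalk q) : MonoidTensor ZMax (thetaStalk q) :=
  MonoidTensor.tmul (A := ZMax) x c

theorem stalkValue_stalkTmul (x : WithBot ℤ) (c : thetaStalk q) :
    stalkValue q (stalkTmul x c) = scaleBot c x := rfl

theorem exists_stalkTmul_eq (t : MonoidTensor ZMax (thetaStalk q)) :
    ∃ x c, stalkTmul x c = t := by
  induction t using Quot.ind with
  | mk z => exact ⟨z.1, z.2, rfl⟩

/-- The tensor relation for `n = 0` applies, as `0` fixes `⊥`. In the next lemma it applies again,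
as `0` sends every integer to `0`. -/
theorem stalkTmul_bot (c : thetaStalk q) : stalkTmul ⊥ c = stalkTmul ⊥ (thetaZero q) := by
  have h : thetaZero q = (0 : ℕ) • c := Subtype.ext (by
    change (0 : ℚ) = ((0 : ℕ) : ℚ) * c
    simp)
  rw [h]
  exact Quot.sound (MonoidTensor.Rel.smul 0 (A := ZMax) (⊥ : WithBot ℤ) c)

theorem stalkTmul_coe_zero (m : ℤ) :
    stalkTmul (m : WithBot ℤ) (thetaZero q) = stalkTmul ((0 : ℤ) : WithBot ℤ) (thetaZero q) := by
  have h : thetaZero q = (0 : ℕ) • thetaZero q := Subtype.ext (by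
    change (0 : ℚ) = ((0 : ℕ) : ℚ) * (0 : ℚ)
    simp)
  have h' : ((0 : ℕ) • (show ZMax from (m : WithBot ℤ))) = ((0 : ℤ) : WithBot ℤ) :=
    congrArg (fun z : ℤ => (z : WithBot ℤ)) (by simp)
  conv_lhs => rw [h]
  rw [← h']
  exact (Quot.sound (MonoidTensor.Rel.smul 0 (A := ZMax) (m : WithBot ℤ) (thetaZero q))).symm

theorem stalkTmul_nsmul (m : ℤ) (n : ℕ) (c : thetaStalk q) :
    stalkTmul (m : WithBot ℤ) (n • c) = stalkTmul ((n * m : ℤ) : WithBot ℤ) c :=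
  (Quot.sound (MonoidTensor.Rel.smul n (A := ZMax) (m : WithBot ℤ) c)).symm

theorem exists_eq_nsmul {c d : thetaStalk q} {m : ℤ} (h : (c : ℚ) = m * (d : ℚ)) :
    ∃ n : ℕ, c = n • d := by
  by_cases hd : (d : ℚ) = 0
  · refine ⟨0, Subtype.ext ?_⟩
    change (c : ℚ) = ((0 : ℕ) : ℚ) * (d : ℚ)
    rw [h, hd]; simp
  · have hd' : 0 < (d : ℚ) := lt_of_le_of_ne d.2.1 (Ne.symm hd)
    have hm : 0 ≤ m := by
      have := c.2.1
      rw [h] at this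
      exact_mod_cast nonneg_of_mul_nonneg_left this hd'
    lift m to ℕ using hm
    exact ⟨m, Subtype.ext h⟩

/-- Writing `c = i • e` and `d = j • e` moves both tensors over `e`, where equal values mean equal
integers unless `e = 0`; over `0` all integers give the same tensor. -/
theorem stalkValue_injective (q : PrimeSpectrum ℤ) : Function.Injective (stalkValue q) := by
  intro t t' h
  obtain ⟨x, c, rfl⟩ := exists_stalkTmul_eq t
  obtain ⟨y, d, rfl⟩ := exists_stalkTmul_eq t'
  rw [stalkValue_stalkTmul, stalkValue_stalkTmul] at h
  cases x with
  | bot =>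
    cases y with
    | bot => rw [stalkTmul_bot, stalkTmul_bot d]
    | coe n => exact absurd h WithBot.bot_ne_coe
  | coe m =>
    cases y with
    | bot => exact absurd h WithBot.coe_ne_bot
    | coe n =>
      have h' : (m : ℚ) * c = n * d := WithBot.coe_injective h
      obtain ⟨e, ⟨i, hi⟩, ⟨j, hj⟩, -⟩ := exists_common_divisor c.2.2 d.2.2 d.2.2
      obtain ⟨i, rfl⟩ := exists_eq_nsmul hi
      obtain ⟨j, rfl⟩ := exists_eq_nsmul hj
      rw [stalkTmul_nsmul, stalkTmul_nsmul]
      by_cases he : (e : ℚ) = 0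
      · obtain rfl : e = thetaZero q := Subtype.ext he
        rw [stalkTmul_coe_zero, stalkTmul_coe_zero (j * n)]
      · have h2 : (m : ℚ) * ((i : ℚ) * (e : ℚ)) = n * ((j : ℚ) * (e : ℚ)) := h'
        have h3 : (i : ℚ) * m = j * n := mul_right_cancel₀ he (by linear_combination h2)
        congr 2
        exact_mod_cast h3

theorem mem_valueGroup_of_stalkValue_eq {t : MonoidTensor ZMax (thetaStalk q)} {r : ℚ}
    (h : stalkValue q t = r) : r ∈ valueGroup q := by
  obtain ⟨x, c, rfl⟩ := exists_stalkTmul_eq t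
  rw [stalkValue_stalkTmul] at h
  cases x with
  | bot => exact absurd h WithBot.bot_ne_coe
  | coe m =>
    rw [← show (m : ℚ) * c = r from WithBot.coe_injective h, ← zsmul_eq_mul]
    exact zsmul_mem c.2.2 m

/-- The graphs on the stalk are defined by triples of tensors with one common second factor, so
three given germs have to be brought to that form. -/
theorem exists_stalkTmul_eq₃ (r s t : MonoidTensor ZMax (thetaStalk q)) :
    ∃ c : thetaStalk q, ∀ u, (u = r ∨ u = s ∨ u = t) →
      (∀ a : ℚ, stalkValue q u = a → ∃ m : ℤ, a = m * (c : ℚ)) ∧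
      stalkTmul (floorBot c (stalkValue q u)) c = u := by
  have hmem : ∀ u : MonoidTensor ZMax (thetaStalk q), ∃ a ∈ valueGroup q,
      ∀ b : ℚ, stalkValue q u = b → b = a := by
    intro u
    cases h : stalkValue q u with
    | bot => exact ⟨0, zero_mem _, fun b hb => absurd hb WithBot.bot_ne_coe⟩
    | coe a =>
      exact ⟨a, mem_valueGroup_of_stalkValue_eq h, fun b hb => (WithBot.coe_injective hb).symm⟩
  obtain ⟨a₁, h₁, h₁'⟩ := hmem r
  obtain ⟨a₂, h₂, h₂'⟩ := hmem s
  obtain ⟨a₃, h₃, h₃'⟩ := hmem t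
  obtain ⟨c, e₁, e₂, e₃⟩ := exists_common_divisor h₁ h₂ h₃
  have key : ∀ u, (u = r ∨ u = s ∨ u = t) →
      ∀ a : ℚ, stalkValue q u = a → ∃ m : ℤ, a = m * (c : ℚ) := by
    rintro u (rfl | rfl | rfl) a ha
    · rwa [h₁' a ha]
    · rwa [h₂' a ha]
    · rwa [h₃' a ha]
  refine ⟨c, fun u hu => ⟨key u hu, stalkValue_injective q ?_⟩⟩
  rw [stalkValue_stalkTmul, scaleBot_floorBot (key u hu)]

theorem zHmax_add_iff {x y z : WithBot ℤ} : zHmax.add x y z ↔ MaxTwice x y z :=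
  MaxTwice.iff_eq_max_or_le.symm

theorem zHmax_mul_iff {x y z : WithBot ℤ} : zHmax.mul x y z ↔ z = x + y := Iff.rfl

/-- Scaling by `c` carries the relations of `ℤ_hmax` to relations of values; over a common `c`,
`floorBot` carries them back. -/
theorem isTropical_stalkValue (q : PrimeSpectrum ℤ) :
    ((thetaInverseImage ZMax zHmax).str q).IsTropical (valueGroup q) (stalkValue q) where
  injective := stalkValue_injective q
  exists_iff t := by
    constructor
    · rintro ⟨u, rfl⟩ r hr
      exact mem_valueGroup_of_stalkValue_eq hr
    · intro h
      cases t with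
      | bot => exact ⟨stalkTmul ⊥ (thetaZero q), rfl⟩
      | coe r =>
        obtain ⟨c, ⟨m, hm⟩, -⟩ := exists_common_divisor (h r rfl) (h r rfl) (h r rfl)
        exact ⟨stalkTmul (m : WithBot ℤ) c, congrArg _ hm.symm⟩
  val_zero := rfl
  val_one := congrArg (fun z : ℚ => (z : WithBot ℚ)) (by simp)
  mul_iff r s t := by
    constructor
    · rintro ⟨x, y, z, c, h, rfl, rfl, rfl⟩
      have h' : z = (show WithBot ℤ from x) + (show WithBot ℤ from y) := h
      subst h'
      exact scaleBot_add c x y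
    · intro h
      obtain ⟨c, hc⟩ := exists_stalkTmul_eq₃ r s t
      refine ⟨_, _, _, c, ?_, (hc r (Or.inl rfl)).2, (hc s (Or.inr (Or.inl rfl))).2, (hc t (Or.inr (Or.inr rfl))).2⟩
      rw [zHmax_mul_iff, h]
      exact floorBot_add (hc r (Or.inl rfl)).1 (hc s (Or.inr (Or.inl rfl))).1
  add_iff r s t := by
    constructor
    · rintro ⟨x, y, z, c, h, rfl, rfl, rfl⟩
      exact (zHmax_add_iff.mp h).map (f := scaleBot c) (monotone_scaleBot c.2.1)
    · intro h
      obtain ⟨c, hc⟩ := exists_stalkTmul_eq₃ r s t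
      exact ⟨_, _, _, c, zHmax_add_iff.mpr (h.map (monotone_floorBot c.2.1)),
        (hc r (Or.inl rfl)).2, (hc s (Or.inr (Or.inl rfl))).2, (hc t (Or.inr (Or.inr rfl))).2⟩

end Tensor

/-! ### Sheaves of hyperrings given by germs -/

namespace HyperSheaf

variable {X : TopCat.{0}}

/-- Two families of germs satisfying `p` which agree at a point agree near that point. -/
def GermExt {T : X → Type} (p : ∀ {U : Opens X}, (∀ x : U, T x) → Prop) : Prop :=
  ∀ (U : Opens X) (f g : ∀ x : U, T x), p f → p g → ∀ x : U, f x = g x →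
    ∃ V : Opens X, x.1 ∈ V ∧ ∀ y : U, y.1 ∈ V → f y = g y

theorem GermExt.sheafify {T : X → Type} {P : TopCat.PrelocalPredicate T}
    (h : GermExt P.pred) : GermExt P.sheafify.pred := by
  intro U f g hf hg x hx
  obtain ⟨V, hV, i, hf⟩ := hf x
  obtain ⟨W, hW, j, hg⟩ := hg x
  obtain ⟨V', hV', hfg⟩ := h (V ⊓ W) _ _ (P.res (Opens.infLELeft V W) _ hf)
    (P.res (Opens.infLERight V W) _ hg) ⟨x.1, hV, hW⟩ hx
  exact ⟨V ⊓ W ⊓ V', ⟨⟨hV, hW⟩, hV'⟩, fun y hy => hfg ⟨y.1, hy.1⟩ hy.2⟩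

theorem GermExt.congr_germ {F : HyperSheaf X} (h : GermExt F.sec.pred) {U V : Opens X}
    {f : ∀ x : U, F.stalk x.1} {g : ∀ x : V, F.stalk x.1} (hf : F.sec.pred f)
    (hg : F.sec.pred g) {x : X} (hU : x ∈ U) (hV : x ∈ V) (hx : f ⟨x, hU⟩ = g ⟨x, hV⟩) :
    ∃ (W : Opens X) (hWU : W ≤ U) (hWV : W ≤ V), x ∈ W ∧
      ∀ y (hy : y ∈ W), f ⟨y, hWU hy⟩ = g ⟨y, hWV hy⟩ := by
  obtain ⟨W, hW, hfg⟩ := h (U ⊓ V) _ _ (F.sec.res (Opens.infLELeft U V) _ hf)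
    (F.sec.res (Opens.infLERight U V) _ hg) ⟨x, hU, hV⟩ hx
  exact ⟨U ⊓ V ⊓ W, inf_le_left.trans inf_le_left, inf_le_left.trans inf_le_right,
    ⟨⟨hU, hV⟩, hW⟩, fun y hy => hfg ⟨y, hy.1⟩ hy.2⟩

/-- Every triple of germs satisfying a relation extends to a triple of local sections
satisfying that relation. -/
def LocallyExtends (F : HyperSheaf X) (r : ∀ x, F.stalk x → F.stalk x → F.stalk x → Prop) : Prop :=
  ∀ (x : X) (a b c : F.stalk x), r x a b c →
    ∃ (U : Opens X) (hx : x ∈ U) (f g h : ∀ y : U, F.stalk y.1),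
      F.sec.pred f ∧ F.sec.pred g ∧ F.sec.pred h ∧
      f ⟨x, hx⟩ = a ∧ g ⟨x, hx⟩ = b ∧ h ⟨x, hx⟩ = c ∧ ∀ y : U, r y.1 (f y) (g y) (h y)

theorem LocallyExtends.isOpen {F : HyperSheaf X}
    {r : ∀ x, F.stalk x → F.stalk x → F.stalk x → Prop} (hr : F.LocallyExtends r)
    (hF : GermExt F.sec.pred) {U : Opens X} {f g h : ∀ y : U, F.stalk y.1}
    (hf : F.sec.pred f) (hg : F.sec.pred g) (hh : F.sec.pred h) (x : U)
    (hx : r x.1 (f x) (g x) (h x)) :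
    ∃ V : Opens X, x.1 ∈ V ∧ ∀ y : U, y.1 ∈ V → r y.1 (f y) (g y) (h y) := by
  obtain ⟨W, hW, f', g', h', hf', hg', hh', ef, eg, eh, H⟩ := hr _ _ _ _ hx
  obtain ⟨W₁, hU₁, hW₁, h₁, e₁⟩ := hF.congr_germ hf hf' x.2 hW ef.symm
  obtain ⟨W₂, hU₂, hW₂, h₂, e₂⟩ := hF.congr_germ hg hg' x.2 hW eg.symm
  obtain ⟨W₃, hU₃, hW₃, h₃, e₃⟩ := hF.congr_germ hh hh' x.2 hW eh.symm
  refine ⟨W₁ ⊓ W₂ ⊓ W₃, ⟨⟨h₁, h₂⟩, h₃⟩, fun y hy => ?_⟩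
  have := H ⟨y.1, hW₁ hy.1.1⟩
  rw [← e₁ y.1 hy.1.1, ← e₂ y.1 hy.1.2, ← e₃ y.1 hy.2] at this
  exact this

theorem isSheafOfHyperrings_of_germExt {F : HyperSheaf X} (hF : GermExt F.sec.pred)
    (hex : ∀ (x : X) (t : F.stalk x), ∃ (U : Opens X) (hx : x ∈ U) (f : ∀ y : U, F.stalk y.1),
      F.sec.pred f ∧ f ⟨x, hx⟩ = t)
    (h0 : ∀ U : Opens X, F.sec.pred fun x : U => (F.str x.1).zero)
    (h1 : ∀ U : Opens X, F.sec.pred fun x : U => (F.str x.1).one)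
    (hmul : F.LocallyExtends fun x => (F.str x).mul)
    (hadd : F.LocallyExtends fun x => (F.str x).add)
    (hyp : ∀ x, (F.str x).IsHyperring) : F.IsSheafOfHyperrings where
  exists_germ x t := by
    obtain ⟨U, hx, f, hf, h⟩ := hex x t
    exact ⟨U, hx, ⟨f, hf⟩, h⟩
  germ_ext U s t x h := hF U s.1 t.1 s.2 t.2 x h
  zero_sec := h0
  one_sec := h1
  mul_open U r s t x h := hmul.isOpen hF r.2 s.2 t.2 x h
  add_open U r s t x h := hadd.isOpen hF r.2 s.2 t.2 x h
  hyperring := hyp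

theorem GermExt.inverseImage {Y : TopCat.{0}} (f : Y ⟶ X) {F : HyperSheaf X}
    (hF : GermExt F.sec.pred) : GermExt (F.inverseImage f).sec.pred := by
  refine GermExt.sheafify ?_
  rintro U t t' ⟨V, hV, s, hs⟩ ⟨V', hV', s', hs'⟩ y hy
  obtain ⟨W, hWV, hWV', hW, e⟩ := hF.congr_germ s.2 s'.2 (hV y) (hV' y)
    ((hs y).symm.trans (hy.trans (hs' y)))
  refine ⟨(Opens.map f).obj W, hW, fun z hz => ?_⟩
  rw [hs, hs']
  exact e _ hz

/-- Stalkwise equivalences transport sections to sections as soon as every germ has one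
local section whose image is a section. -/
theorem pred_comp_iff {F G : HyperSheaf X} (hF : GermExt F.sec.pred) (hG : GermExt G.sec.pred)
    (φ : ∀ x, F.stalk x ≃ G.stalk x)
    (hφ : ∀ (x : X) (t : F.stalk x), ∃ (U : Opens X) (hx : x ∈ U) (f : ∀ y : U, F.stalk y.1),
      F.sec.pred f ∧ G.sec.pred (fun y => φ y.1 (f y)) ∧ f ⟨x, hx⟩ = t)
    {U : Opens X} (f : ∀ x : U, F.stalk x.1) :
    F.sec.pred f ↔ G.sec.pred fun x => φ x.1 (f x) := by
  constructor
  · intro hf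
    refine G.sec.locality _ fun x => ?_
    obtain ⟨V, hV, g, hg, hg', e⟩ := hφ x.1 (f x)
    obtain ⟨W, hWU, hWV, hW, h⟩ := hF.congr_germ hf hg x.2 hV e.symm
    refine ⟨W, hW, homOfLE hWU, ?_⟩
    have := G.sec.res (homOfLE hWV) _ hg'
    convert this using 2 with y
    exact congrArg _ (h y.1 y.2)
  · intro hf
    refine F.sec.locality _ fun x => ?_
    obtain ⟨V, hV, g, hg, hg', e⟩ := hφ x.1 (f x)
    obtain ⟨W, hWU, hWV, hW, h⟩ := hG.congr_germ hf hg' x.2 hV (congrArg _ e.symm)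
    refine ⟨W, hW, homOfLE hWU, ?_⟩
    have := F.sec.res (homOfLE hWV) _ hg
    convert this using 2 with y
    exact (φ y.1).injective (h y.1 y.2)

/-- The isomorphism of sheaves defined by equivalences of the stalks which identify
the sections. -/
def isoOfStalkEquiv {F G : HyperSheaf X} (φ : ∀ x, F.stalk x ≃ G.stalk x)
    (h : ∀ {U : Opens X} (f : ∀ x : U, F.stalk x.1),
      F.sec.pred f ↔ G.sec.pred fun x => φ x.1 (f x)) : F.toSheaf ≅ G.toSheaf where
  hom := ⟨{ app := fun U => ↾fun s => ⟨fun x => φ x.1 (s.1 x), (h s.1).mp s.2⟩ }⟩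
  inv := ⟨{ app := fun U => ↾fun s => ⟨fun x => (φ x.1).symm (s.1 x), (h _).mpr (by
    simpa only [Equiv.apply_symm_apply] using s.2)⟩ }⟩
  hom_inv_id := by
    refine ObjectProperty.hom_ext _ (NatTrans.ext (funext fun U => ?_))
    ext s
    exact Subtype.ext (funext fun x => (φ x.1).symm_apply_apply _)
  inv_hom_id := by
    refine ObjectProperty.hom_ext _ (NatTrans.ext (funext fun U => ?_))
    ext s
    exact Subtype.ext (funext fun x => (φ x.1).apply_symm_apply _)

theorem germ_mapSec_isoOfStalkEquiv {F G : HyperSheaf X} (φ : ∀ x, F.stalk x ≃ G.stalk x)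
    (h : ∀ {U : Opens X} (f : ∀ x : U, F.stalk x.1),
      F.sec.pred f ↔ G.sec.pred fun x => φ x.1 (f x)) {U : Opens X} (s : F.Sections U) (x : U) :
    G.germ (mapSec (isoOfStalkEquiv φ h) s) x = φ x.1 (F.germ s x) := rfl

/-- The restriction of a section. -/
def resSec {F : HyperSheaf X} {U V : Opens X} (hVU : V ≤ U) (s : F.Sections U) : F.Sections V :=
  F.toSheaf.presheaf.map (homOfLE hVU).op s

theorem mapSec_resSec {F G : HyperSheaf X} (Φ : F.toSheaf ≅ G.toSheaf) {U V : Opens X}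
    (hVU : V ≤ U) (s : F.Sections U) : mapSec Φ (resSec hVU s) = resSec hVU (mapSec Φ s) :=
  NatTrans.naturality_apply Φ.hom.hom (homOfLE hVU).op s

theorem sections_ext {F : HyperSheaf X} {U : Opens X} {s t : F.Sections U}
    (h : ∀ x, F.germ s x = F.germ t x) : s = t :=
  Subtype.ext (funext h)

theorem iso_ext {F G : HyperSheaf X} {Φ Ψ : F.toSheaf ≅ G.toSheaf}
    (h : ∀ (U : Opens X) (s : F.Sections U) (x : U),
      G.germ (mapSec Φ s) x = G.germ (mapSec Ψ s) x) : Φ = Ψ := by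
  refine Iso.ext (ObjectProperty.hom_ext _ (NatTrans.ext (funext fun U => ?_)))
  ext s
  exact sections_ext (h U.unop s)

end HyperSheaf

/-! ### Germs of Cartier divisor classes -/

open HyperSheaf

section Cartier

variable {R K : Type} [CommRing R] [Field K] [Algebra R K]

variable (R) in
theorem cartierSheaf_pred_mk [IsDomain R] [IsFractionRing R K]
    (U : Opens (TopCat.of (PrimeSpectrum R))) (f : K) :
    (cartierSheaf R K).sec.pred fun x : U => UnitQuotient.mk (localUnits R K x.1) f :=
  TopCat.PrelocalPredicate.sheafifyOf ⟨f, fun _ => rfl⟩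

variable (R K) in
-- Representatives of the same class at a point differ by a local unit, and this remains a unit
-- nearby.
theorem germExt_cartierSheaf : GermExt (cartierSheaf R K).sec.pred := by
  refine GermExt.sheafify ?_
  rintro U s t ⟨f, hf⟩ ⟨g, hg⟩ x hx
  have h : UnitQuotient.mk (localUnits R K x.1) f = UnitQuotient.mk (localUnits R K x.1) g :=
    (hf x).symm.trans (hx.trans (hg x))
  obtain ⟨u, hu, rfl⟩ := mk_eq_mk_iff.mp h
  obtain ⟨V, hV, hu⟩ := hu.exists_nhds
  refine ⟨V, hV, fun y hy => (hf y).trans (Eq.trans ?_ (hg y).symm)⟩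
  exact mk_eq_mk_iff.mpr ⟨u, hu y.1 hy, rfl⟩

end Cartier

/-! ### Germs of the sheaf `Θ^* ℤ_max` -/

theorem isClosed_singleton_of_thetaStalk {q : PrimeSpectrum ℤ} {c : thetaStalk q}
    (hc : (c : ℚ) ≠ 0) : IsClosed ({q} : Set (PrimeSpectrum ℤ)) := by
  rw [PrimeSpectrum.isClosed_singleton_iff_isMaximal]
  obtain ⟨p, hp, hq, -⟩ := c.2.2.resolve_left hc
  refine IsPrime.to_maximal_ideal fun h => ?_
  rw [h, Ideal.mem_bot] at hq
  exact hp.ne_zero (by exact_mod_cast hq)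

/-- The support is a finite set of closed points, and those other than `q` can be removed. -/
theorem IsThetaSection.exists_nhds {U : Opens (TopCat.of (PrimeSpectrum ℤ))}
    {c : ∀ q : U, thetaStalk q.1} (hc : IsThetaSection c) (q : U) :
    ∃ V : Opens (TopCat.of (PrimeSpectrum ℤ)), q.1 ∈ V ∧
      ∀ y : U, y.1 ∈ V → y ≠ q → c y = thetaZero y.1 := by
  set T : Set U := {y | (c y : ℚ) ≠ 0 ∧ y ≠ q} with hT
  have hfin : T.Finite := Set.Finite.subset hc fun y hy => hy.1
  have hcl : IsClosed (Subtype.val '' T : Set (PrimeSpectrum ℤ)) := by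
    rw [← Set.biUnion_of_singleton (Subtype.val '' T)]
    refine (hfin.image _).isClosed_biUnion ?_
    rintro _ ⟨y, hy, rfl⟩
    exact isClosed_singleton_of_thetaStalk hy.1
  refine ⟨⟨(Subtype.val '' T)ᶜ, hcl.isOpen_compl⟩, ?_, fun y hy hne => ?_⟩
  · rintro ⟨y, hy, h⟩
    exact hy.2 (Subtype.ext h)
  · by_contra h
    exact hy ⟨y, ⟨fun h0 => h (Subtype.ext h0), hne⟩, rfl⟩

theorem stalkTmul_thetaZero_congr {x y : WithBot ℤ} (h : x = ⊥ ↔ y = ⊥) (q : PrimeSpectrum ℤ) :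
    stalkTmul x (thetaZero q) = stalkTmul y (thetaZero q) := by
  cases x with
  | bot => rw [h.mp rfl]
  | coe m =>
    cases y with
    | bot => exact absurd (h.mpr rfl) WithBot.coe_ne_bot
    | coe n => rw [stalkTmul_coe_zero, stalkTmul_coe_zero n]

theorem scaleBot_eq_bot_iff {c : ℚ} {x : WithBot ℤ} : scaleBot c x = ⊥ ↔ x = ⊥ := by
  cases x with
  | bot => exact iff_of_true rfl rfl
  | coe m => exact iff_of_false WithBot.coe_ne_bot WithBot.coe_ne_bot

/-- Near `q`, but off `q`, the sections are `x ⊗ 0` and `y ⊗ 0`. These depend only on whether `x`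
and `y` are `⊥`, which the germs at `q` already decide. -/
theorem germExt_thetaInverseImage :
    GermExt (thetaInverseImage ZMax zHmax).sec.pred := by
  refine GermExt.sheafify ?_
  rintro U s t ⟨x, c, hc, hs⟩ ⟨y, d, hd, ht⟩ q hq
  obtain ⟨V, hV, hcV⟩ := hc.exists_nhds q
  obtain ⟨W, hW, hdW⟩ := hd.exists_nhds q
  refine ⟨V ⊓ W, ⟨hV, hW⟩, fun r hr => ?_⟩
  by_cases h : r = q
  · rw [h, hq]
  · have hxy : stalkTmul x (c q) = stalkTmul y (d q) := (hs q).symm.trans (hq.trans (ht q))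
    have hbot : (show WithBot ℤ from x) = ⊥ ↔ (show WithBot ℤ from y) = ⊥ := by
      rw [← scaleBot_eq_bot_iff (c := (c q : ℚ)), ← scaleBot_eq_bot_iff (c := (d q : ℚ)),
        ← stalkValue_stalkTmul, ← stalkValue_stalkTmul, hxy]
    rw [hs, ht, hcV r hr.1 h, hdW r hr.2 h]
    exact stalkTmul_thetaZero_congr hbot r.1

theorem germExt_pullbackStructureSheaf : GermExt pullbackStructureSheaf.sec.pred :=
  germExt_thetaInverseImage.inverseImage specMap

open Classical in
/-- The family of elements of the stalks of `𝒮` with value `c` at `q` and zero elsewhere. -/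
noncomputable def thetaSingle (q : PrimeSpectrum ℤ) (c : thetaStalk q) (r : PrimeSpectrum ℤ) :
    thetaStalk r :=
  if h : r = q then h ▸ c else thetaZero r

theorem thetaSingle_same (q : PrimeSpectrum ℤ) (c : thetaStalk q) : thetaSingle q c q = c := by
  rw [thetaSingle, dif_pos rfl]

theorem thetaSingle_of_ne {q r : PrimeSpectrum ℤ} (c : thetaStalk q) (h : r ≠ q) :
    thetaSingle q c r = thetaZero r := dif_neg h

theorem thetaSingle_thetaZero (q r : PrimeSpectrum ℤ) :
    thetaSingle q (thetaZero q) r = thetaZero r := by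
  by_cases h : r = q
  · subst h; exact thetaSingle_same _ _
  · exact thetaSingle_of_ne _ h

/-- A family supported at one point is a section of `𝒮`, so every pure tensor in a stalk extends to
a global section. -/
theorem pullbackStructureSheaf_pred_stalkTmul
    (U : Opens (TopCat.of (PrimeSpectrum Ocyc))) (x : WithBot ℤ) (q : PrimeSpectrum ℤ)
    (c : thetaStalk q) :
    pullbackStructureSheaf.sec.pred fun P : U =>
      stalkTmul x (thetaSingle q c (specMap P.1)) := by
  refine TopCat.PrelocalPredicate.sheafifyOf ⟨⊤, fun _ => trivial,
    ⟨fun r => stalkTmul x (thetaSingle q c r.1), ?_⟩, fun _ => rfl⟩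
  refine TopCat.PrelocalPredicate.sheafifyOf ⟨x, fun r => thetaSingle q c r.1, ?_, fun _ => rfl⟩
  refine Set.Finite.subset (Set.finite_singleton ⟨q, trivial⟩) fun r hr => ?_
  by_contra h
  exact hr (congrArg Subtype.val (thetaSingle_of_ne c fun e => h (Subtype.ext e)))

theorem isSheafOfHyperrings_pullbackStructureSheaf :
    pullbackStructureSheaf.IsSheafOfHyperrings := by
  -- A relation between `x`, `y`, `z` in `ℤ_max` does not involve the point; only the common factor
  -- `d` is spread out by `thetaSingle`.
  have key : ∀ r : WithBot ℤ → WithBot ℤ → WithBot ℤ → Prop,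
      pullbackStructureSheaf.LocallyExtends fun P a b c =>
        ∃ (x y z : WithBot ℤ) (d : thetaStalk (specMap P)), r x y z ∧
          stalkTmul x d = a ∧ stalkTmul y d = b ∧ stalkTmul z d = c := by
    rintro r P _ _ _ ⟨x, y, z, d, hr, rfl, rfl, rfl⟩
    refine ⟨⊤, trivial, _, _, _, pullbackStructureSheaf_pred_stalkTmul ⊤ x (specMap P) d,
      pullbackStructureSheaf_pred_stalkTmul ⊤ y (specMap P) d,
      pullbackStructureSheaf_pred_stalkTmul ⊤ z (specMap P) d, ?_, ?_, ?_,
      fun Q => ⟨x, y, z, _, hr, rfl, rfl, rfl⟩⟩ <;>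
    exact congrArg _ (thetaSingle_same _ _)
  have h0 : ∀ (x : WithBot ℤ) (U : Opens (TopCat.of (PrimeSpectrum Ocyc))),
      pullbackStructureSheaf.sec.pred fun P : U => stalkTmul x (thetaZero (specMap P.1)) := by
    intro x U
    have := pullbackStructureSheaf_pred_stalkTmul U x ⊥ (thetaZero ⊥)
    simpa only [thetaSingle_thetaZero] using this
  refine isSheafOfHyperrings_of_germExt germExt_pullbackStructureSheaf (fun P t => ?_)
    (h0 ⊥) (h0 (0 : ℤ)) (key zHmax.mul) (key zHmax.add)
    (fun P => (isTropical_stalkValue (specMap P)).isHyperring)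
  obtain ⟨x, c, rfl⟩ := exists_stalkTmul_eq t
  exact ⟨⊤, trivial, _, pullbackStructureSheaf_pred_stalkTmul ⊤ x (specMap P) c,
    congrArg _ (thetaSingle_same _ _)⟩
/-! ### The stalks of the sheaf of Cartier divisor classes -/

theorem negValue_coe (r : ℚ) : negValue r = ((-r : ℚ) : WithBot ℚ) := rfl

theorem negValue_top : negValue ⊤ = ⊥ := rfl

theorem negValue_le_negValue {a b : WithTop ℚ} : negValue a ≤ negValue b ↔ b ≤ a := by
  cases a with
  | top => exact iff_of_true bot_le le_top
  | coe r =>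
    cases b with
    | top => exact iff_of_false (not_le.mpr (WithBot.bot_lt_coe _)) (not_le.mpr (WithTop.coe_lt_top _))
    | coe s =>
      rw [negValue_coe, negValue_coe, WithBot.coe_le_coe, WithTop.coe_le_coe, neg_le_neg_iff]

theorem negValue_injective : Function.Injective negValue := fun _ _ h =>
  le_antisymm (negValue_le_negValue.mp h.ge) (negValue_le_negValue.mp h.le)

theorem negValue_add (a b : WithTop ℚ) : negValue (a + b) = negValue a + negValue b := by
  cases a with
  | top => rfl
  | coe r =>
    cases b with
    | top => rfl
    | coe s => exact congrArg (fun z : ℚ => (z : WithBot ℚ)) (neg_add r s)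

theorem maxTwice_negValue_iff {a b c : WithTop ℚ} :
    MaxTwice (negValue a) (negValue b) (negValue c) ↔
      min b c ≤ a ∧ min a c ≤ b ∧ min a b ≤ c := by
  simp only [MaxTwice, le_max_iff, min_le_iff, negValue_le_negValue]

section CartierStalk

variable {R K : Type} [CommRing R] [Field K] [Algebra R K] {x : PrimeSpectrum R}
  {w : AddValuation K (WithTop ℚ)}

theorem mk_eq_mk_iff_valuation_eq (hw : ∀ f, 0 ≤ w f ↔ f ∈ localRing R K x) {f g : K} :
    UnitQuotient.mk (localUnits R K x) f = UnitQuotient.mk (localUnits R K x) g ↔ w f = w g := by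
  rw [mk_eq_mk_iff]
  constructor
  · rintro ⟨u, hu, rfl⟩
    rw [w.map_mul, (AddValuation.eq_zero_iff_isLocalUnit hw).mpr hu, zero_add]
  · intro h
    by_cases hg : g = 0
    · rw [hg, w.map_zero, w.top_iff] at h
      exact ⟨1, .one, by rw [h, hg, mul_zero]⟩
    · refine ⟨f / g, (AddValuation.eq_zero_iff_isLocalUnit hw).mp ?_, by field_simp⟩
      obtain ⟨r, hr⟩ := w.exists_rat_eq hg
      rw [w.map_div, h, hr, ← WithTop.LinearOrderedAddCommGroup.coe_sub, sub_self, WithTop.coe_zero]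

/-- The map `f ↦ -w f` on the quotient of `K` by the units of the valuation ring of `w`. -/
def negValuation (hw : ∀ f, 0 ≤ w f ↔ f ∈ localRing R K x) :
    UnitQuotient K (localUnits R K x) → WithBot ℚ :=
  Quotient.lift (fun f => negValue (w f)) fun _ _ h =>
    congrArg negValue ((mk_eq_mk_iff_valuation_eq hw).mp (Quotient.sound h))

theorem negValuation_mk (hw : ∀ f, 0 ≤ w f ↔ f ∈ localRing R K x) (f : K) :
    negValuation hw (UnitQuotient.mk (localUnits R K x) f) = negValue (w f) := rfl

theorem exists_mk_eq (t : UnitQuotient K (localUnits R K x)) :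
    ∃ f, UnitQuotient.mk (localUnits R K x) f = t := by
  induction t using Quotient.ind with
  | _ f => exact ⟨f, rfl⟩

/-- If the residue field has more than two elements, then an element is in the sum of two
classes as soon as the minimum of the three valuations is attained twice. -/
theorem exists_add_of_maxTwice (hw : ∀ f, 0 ≤ w f ↔ f ∈ localRing R K x)
    (hu : ∃ u : K, IsLocalUnit R x u ∧ IsLocalUnit R x (1 - u)) {f g h : K}
    (H : MaxTwice (negValue (w f)) (negValue (w g)) (negValue (w h))) :
    ∃ a b : K, w a = w f ∧ w b = w g ∧ w (a + b) = w h := by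
  rw [maxTwice_negValue_iff] at H
  obtain ⟨h1, h2, h3⟩ := H
  rcases eq_or_ne (w f) (w g) with hfg | hfg
  · rw [← hfg, min_self] at h3
    rcases h3.eq_or_lt with h3 | h3
    -- All three valuations are equal: over a residue field with two elements this case would fail.
    · obtain ⟨u, hu, hu'⟩ := hu
      refine ⟨u * h, (1 - u) * h, ?_, ?_, ?_⟩
      · rw [w.map_mul, (AddValuation.eq_zero_iff_isLocalUnit hw).mpr hu, zero_add, h3]
      · rw [w.map_mul, (AddValuation.eq_zero_iff_isLocalUnit hw).mpr hu', zero_add, ← hfg, h3]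
      · rw [← add_mul, add_sub_cancel, one_mul]
    · refine ⟨f, h - f, rfl, ?_, by rw [add_sub_cancel]⟩
      rw [w.map_sub_eq_of_lt_right h3, hfg]
  -- The sum of elements of distinct valuations has the smaller one, which is also forced on `h`.
  · refine ⟨f, g, rfl, rfl, ?_⟩
    rw [w.map_add_of_distinct_val hfg]
    rcases hfg.lt_or_gt with hlt | hlt
    · rw [min_eq_left hlt.le] at h3 ⊢
      exact le_antisymm h3 ((min_le_iff.mp h1).resolve_left hlt.not_ge)
    · rw [min_eq_right hlt.le] at h3 ⊢
      exact le_antisymm h3 ((min_le_iff.mp h2).resolve_left hlt.not_ge)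

theorem isTropical_negValuation (hw : ∀ f, 0 ≤ w f ↔ f ∈ localRing R K x)
    (hu : ∃ u : K, IsLocalUnit R x u ∧ IsLocalUnit R x (1 - u)) {S : AddSubgroup ℚ}
    (hS : ∀ r : ℚ, (∃ f, w f = r) ↔ r ∈ S) :
    (UnitQuotient.str K (localUnits R K x)).IsTropical S (negValuation hw) where
  injective s t h := by
    obtain ⟨f, rfl⟩ := exists_mk_eq s
    obtain ⟨g, rfl⟩ := exists_mk_eq t
    exact (mk_eq_mk_iff_valuation_eq hw).mpr (negValue_injective h)
  exists_iff t := by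
    constructor
    · rintro ⟨s, rfl⟩ r hr
      obtain ⟨f, rfl⟩ := exists_mk_eq s
      rw [negValuation_mk] at hr
      rw [← neg_neg r]
      refine S.neg_mem ((hS _).mp ⟨f, negValue_injective ?_⟩)
      rw [hr, negValue_coe, neg_neg]
    · intro h
      cases t with
      | bot => exact ⟨UnitQuotient.mk _ 0, by rw [negValuation_mk, w.map_zero, negValue_top]⟩
      | coe r =>
        obtain ⟨f, hf⟩ := (hS (-r)).mpr (S.neg_mem (h r rfl))
        exact ⟨UnitQuotient.mk _ f, by rw [negValuation_mk, hf, negValue_coe, neg_neg]⟩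
  val_zero := by
    change negValue (w 0) = ⊥
    rw [w.map_zero, negValue_top]
  val_one := by
    change negValue (w 1) = 0
    rw [w.map_one]
    exact congrArg (fun z : ℚ => (z : WithBot ℚ)) neg_zero
  mul_iff r s t := by
    constructor
    · rintro ⟨f, g, rfl, rfl, rfl⟩
      rw [negValuation_mk, negValuation_mk, negValuation_mk, w.map_mul, negValue_add]
    · intro h
      obtain ⟨a, rfl⟩ := exists_mk_eq r
      obtain ⟨b, rfl⟩ := exists_mk_eq s
      obtain ⟨c, rfl⟩ := exists_mk_eq t
      rw [negValuation_mk, negValuation_mk, negValuation_mk, ← negValue_add, ← w.map_mul] at h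
      exact ⟨a, b, rfl, rfl, (mk_eq_mk_iff_valuation_eq hw).mpr (negValue_injective h.symm)⟩
  add_iff r s t := by
    constructor
    · rintro ⟨f, g, rfl, rfl, rfl⟩
      rw [negValuation_mk, negValuation_mk, negValuation_mk, maxTwice_negValue_iff]
      -- The other two inequalities come from `f = (f + g) - g` and `g = (f + g) - f`.
      refine ⟨?_, ?_, w.map_add f g⟩
      · simpa [min_comm] using w.map_sub (f + g) g
      · simpa [min_comm] using w.map_sub (f + g) f
    · intro h
      obtain ⟨f, rfl⟩ := exists_mk_eq r
      obtain ⟨g, rfl⟩ := exists_mk_eq s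
      obtain ⟨k, rfl⟩ := exists_mk_eq t
      obtain ⟨a, b, ha, hb, hab⟩ := exists_add_of_maxTwice hw hu h
      exact ⟨a, b, (mk_eq_mk_iff_valuation_eq hw).mpr ha, (mk_eq_mk_iff_valuation_eq hw).mpr hb,
        (mk_eq_mk_iff_valuation_eq hw).mpr hab⟩

theorem isSheafOfHyperrings_cartierSheaf [IsDomain R] [IsFractionRing R K]
    (h : ∀ x, (UnitQuotient.str K (localUnits R K x)).IsHyperring) :
    (cartierSheaf R K).IsSheafOfHyperrings := by
  refine isSheafOfHyperrings_of_germExt (germExt_cartierSheaf R K) (fun x t => ?_)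
    (fun U => cartierSheaf_pred_mk R U 0) (fun U => cartierSheaf_pred_mk R U 1) ?_ ?_ h
  · obtain ⟨f, rfl⟩ := exists_mk_eq t
    exact ⟨⊤, trivial, _, cartierSheaf_pred_mk R ⊤ f, rfl⟩
  · rintro x _ _ _ ⟨a, b, rfl, rfl, rfl⟩
    exact ⟨⊤, trivial, _, _, _, cartierSheaf_pred_mk R ⊤ a, cartierSheaf_pred_mk R ⊤ b,
      cartierSheaf_pred_mk R ⊤ (a * b), rfl, rfl, rfl, fun y => ⟨a, b, rfl, rfl, rfl⟩⟩
  · rintro x _ _ _ ⟨a, b, rfl, rfl, rfl⟩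
    exact ⟨⊤, trivial, _, _, _, cartierSheaf_pred_mk R ⊤ a, cartierSheaf_pred_mk R ⊤ b,
      cartierSheaf_pred_mk R ⊤ (a + b), rfl, rfl, rfl, fun y => ⟨a, b, rfl, rfl, rfl⟩⟩

end CartierStalk

/-! ### Valuations at all points of `Spec 𝒪^cyc` -/

theorem natCast_mem_specMap_iff {P : PrimeSpectrum Ocyc} {p : ℕ} :
    (p : ℤ) ∈ (specMap P).asIdeal ↔ (p : Ocyc) ∈ P.asIdeal := by
  change algebraMap ℤ Ocyc (p : ℤ) ∈ P.asIdeal ↔ _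
  rw [map_natCast]

/-- By integrality a non-zero prime of `𝒪^cyc` contracts to a non-zero prime of `ℤ`. -/
theorem eq_bot_or_exists_prime_mem (P : PrimeSpectrum Ocyc) :
    P.asIdeal = ⊥ ∨ ∃ p : ℕ, p.Prime ∧ (p : Ocyc) ∈ P.asIdeal := by
  refine or_iff_not_imp_left.mpr fun h => ?_
  obtain ⟨a, ha, ha0⟩ := Submodule.exists_mem_ne_zero_of_ne_bot h
  have hc : P.asIdeal.comap (algebraMap ℤ Ocyc) ≠ ⊥ :=
    Ideal.comap_ne_bot_of_integral_mem ha0 ha (NumberField.RingOfIntegers.isIntegral a)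
  have hp : (P.asIdeal.comap (algebraMap ℤ Ocyc)).IsPrime := Ideal.comap_isPrime _ _
  have hg := Submodule.IsPrincipal.prime_generator_of_isPrime _ hc
  refine ⟨_, Int.prime_iff_natAbs_prime.mp hg, natCast_mem_specMap_iff.mp ?_⟩
  rw [Int.natCast_natAbs]
  exact (abs_mem_iff (S := Ideal ℤ)).mpr (Submodule.IsPrincipal.generator_mem _)

/-- `w` has the local ring at `P` as its valuation ring, and it is normalized when `P` is not
the generic point. -/
structure IsPointValuation (P : PrimeSpectrum Ocyc) (w : AddValuation Qcyc (WithTop ℚ)) :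
    Prop where
  nonneg_iff : ∀ f : Qcyc, 0 ≤ w f ↔ f ∈ localRing Ocyc Qcyc P
  isNormalized : ∀ p : ℕ, p.Prime → (p : Ocyc) ∈ P.asIdeal → IsNormalizedValuation p P w

/-- The trivial valuation serves at the generic point, so that all stalks can be treated alike. -/
theorem exists_isPointValuation (P : PrimeSpectrum Ocyc) : ∃ w, IsPointValuation P w := by
  classical
  rcases eq_bot_or_exists_prime_mem P with h | ⟨p, hp, hP⟩
  · let w : AddValuation Qcyc (WithTop ℚ) := AddValuation.of (fun f => if f = 0 then ⊤ else 0)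
      (if_pos rfl) (if_neg one_ne_zero) (fun f g => by
        by_cases hf : f = 0
        · simp [hf]
        · by_cases hg : g = 0
          · simp [hg]
          · by_cases hfg : f + g = 0 <;> simp [hf, hg, hfg])
      (fun f g => by
        by_cases hf : f = 0
        · simp [hf]
        · by_cases hg : g = 0 <;> simp [hf, hg])
    refine ⟨w, ⟨fun f => iff_of_true ?_ ?_, fun p hp hP => ?_⟩⟩
    · change (0 : WithTop ℚ) ≤ if f = 0 then ⊤ else 0
      split_ifs
      exacts [le_top, le_rfl]
    · by_cases hf : f = 0
      · rw [hf]; exact zero_mem (localSubring Ocyc Qcyc P)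
      · exact (isLocalUnit_of_asIdeal_eq_bot h hf).2.1
    · rw [h, Ideal.mem_bot] at hP
      exact absurd hP (Nat.cast_ne_zero.mpr hp.ne_zero)
  · obtain ⟨w, hw, -⟩ := existsUnique_isNormalizedValuation hp hP
    refine ⟨w, hw.nonneg_iff, fun p' hp' hP' => ?_⟩
    obtain rfl := prime_eq_of_mem_asIdeal hp hp' (natCast_mem_specMap_iff.mpr hP)
      (natCast_mem_specMap_iff.mpr hP')
    exact hw

theorem IsPointValuation.exists_eq_iff {P : PrimeSpectrum Ocyc}
    {w : AddValuation Qcyc (WithTop ℚ)} (hw : IsPointValuation P w) (r : ℚ) :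
    (∃ f, w f = r) ↔ r ∈ valueGroup (specMap P) := by
  rcases eq_bot_or_exists_prime_mem P with h | ⟨p, hp, hP⟩
  · rw [mem_valueGroup_iff_of_forall_notMem fun p hp hP => by
      rw [natCast_mem_specMap_iff, h, Ideal.mem_bot] at hP
      exact Nat.cast_ne_zero.mpr hp.ne_zero hP]
    constructor
    · rintro ⟨f, hf⟩
      have h0 : f ≠ 0 := w.ne_top_iff.mp (hf ▸ WithTop.coe_ne_top)
      rw [(AddValuation.eq_zero_iff_isLocalUnit hw.nonneg_iff).mpr
        (isLocalUnit_of_asIdeal_eq_bot h h0)] at hf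
      exact_mod_cast hf.symm
    · rintro rfl
      exact ⟨1, w.map_one⟩
  · rw [mem_valueGroup_iff hp (natCast_mem_specMap_iff.mpr hP)]
    constructor
    · rintro ⟨f, hf⟩
      exact (hw.isNormalized p hp hP).mem_fractionGroup hp hP hf
    · intro hr
      obtain ⟨g, -, hg, -⟩ := exists_forall_isNormalizedValuation_eq hp hr
      exact ⟨g, hg P w (hw.isNormalized p hp hP)⟩

/-- The residue fields of `𝒪^cyc` have more than two elements, because `-ζ - ζ² = 1` for a
primitive third root of unity `ζ`. -/
theorem exists_isLocalUnit_one_sub (P : PrimeSpectrum Ocyc) :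
    ∃ u : Qcyc, IsLocalUnit Ocyc P u ∧ IsLocalUnit Ocyc P (1 - u) := by
  have hz := isPrimitiveRoot_zetaCyc 3
  have hu : IsLocalUnit Ocyc P (zetaCyc 3) :=
    IsLocalUnit.of_isUnit (a := hz.toInteger) (hz.toInteger_isPrimitiveRoot.isUnit three_ne_zero)
  refine ⟨-zetaCyc 3, hu.neg, ?_⟩
  have h : 1 - -zetaCyc 3 = -(zetaCyc 3) ^ 2 := by
    have := hz.geom_sum_eq_zero (by norm_num)
    simp only [Finset.sum_range_succ, Finset.sum_range_zero] at this
    linear_combination this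
  rw [h]
  exact (hu.pow 2).neg
/-! ### The isomorphism -/

theorem HyperStr.IsTropical.exists_equiv {A B : Type} {h : HyperStr A} {h' : HyperStr B}
    {S : AddSubgroup ℚ} {val : A → WithBot ℚ} {val' : B → WithBot ℚ} (H : h.IsTropical S val)
    (H' : h'.IsTropical S val') : ∃ φ : A ≃ B, ∀ a, val' (φ a) = val a := by
  have h₁ : ∀ a, ∃ b, val' b = val a := fun a =>
    (H'.exists_iff _).mpr ((H.exists_iff _).mp ⟨a, rfl⟩)
  have h₂ : ∀ b, ∃ a, val a = val' b := fun b =>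
    (H.exists_iff _).mpr ((H'.exists_iff _).mp ⟨b, rfl⟩)
  choose f hf using h₁
  choose g hg using h₂
  exact ⟨⟨f, g, fun a => H.injective (by rw [hg, hf]), fun b => H'.injective (by rw [hf, hg])⟩, hf⟩

namespace HyperSheaf

variable {X : TopCat.{0}} {F G : HyperSheaf X}

theorem isHyperringIso_isoOfStalkEquiv (φ : ∀ x, F.stalk x ≃ G.stalk x)
    (h : ∀ {U : Opens X} (f : ∀ x : U, F.stalk x.1),
      F.sec.pred f ↔ G.sec.pred fun x => φ x.1 (f x))
    {S : X → AddSubgroup ℚ} {val : ∀ x, F.stalk x → WithBot ℚ} {val' : ∀ x, G.stalk x → WithBot ℚ}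
    (H : ∀ x, (F.str x).IsTropical (S x) (val x)) (H' : ∀ x, (G.str x).IsTropical (S x) (val' x))
    (hφ : ∀ x a, val' x (φ x a) = val x a) : IsHyperringIso (isoOfStalkEquiv φ h) where
  zero_iff s := forall_congr' fun x => by
    rw [germ_mapSec_isoOfStalkEquiv, ← (H x.1).injective.eq_iff, ← (H' x.1).injective.eq_iff, hφ,
      (H x.1).val_zero, (H' x.1).val_zero]
  one_iff s := forall_congr' fun x => by
    rw [germ_mapSec_isoOfStalkEquiv, ← (H x.1).injective.eq_iff, ← (H' x.1).injective.eq_iff, hφ,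
      (H x.1).val_one, (H' x.1).val_one]
  mul_iff r s t := forall_congr' fun x => by
    simp only [germ_mapSec_isoOfStalkEquiv, (H x.1).mul_iff, (H' x.1).mul_iff, hφ]
  add_iff r s t := forall_congr' fun x => by
    simp only [germ_mapSec_isoOfStalkEquiv, (H x.1).add_iff, (H' x.1).add_iff, hφ]

/-- `IsHyperringIso` concerns sections; a section with zero germ at `x` is the zero section near
`x`, which transfers the condition to germs. -/
theorem germ_mapSec_eq_zero (hF : F.IsSheafOfHyperrings) {Φ : F.toSheaf ≅ G.toSheaf}
    (hΦ : IsHyperringIso Φ) {U : Opens X} (s : F.Sections U) (x : U)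
    (hx : F.germ s x = (F.str x.1).zero) : G.germ (mapSec Φ s) x = (G.str x.1).zero := by
  obtain ⟨V, hV, h⟩ := hF.germ_ext U s ⟨_, hF.zero_sec U⟩ x hx
  have hVU : U ⊓ V ≤ U := inf_le_left
  have := (hΦ.zero_iff (resSec hVU s)).mp fun y => h ⟨y.1, y.2.1⟩ y.2.2
  rw [mapSec_resSec] at this
  exact this ⟨x.1, x.2, hV⟩

theorem germ_mapSec_eq_one (hF : F.IsSheafOfHyperrings) {Φ : F.toSheaf ≅ G.toSheaf}
    (hΦ : IsHyperringIso Φ) {U : Opens X} (s : F.Sections U) (x : U)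
    (hx : F.germ s x = (F.str x.1).one) : G.germ (mapSec Φ s) x = (G.str x.1).one := by
  obtain ⟨V, hV, h⟩ := hF.germ_ext U s ⟨_, hF.one_sec U⟩ x hx
  have hVU : U ⊓ V ≤ U := inf_le_left
  have := (hΦ.one_iff (resSec hVU s)).mp fun y => h ⟨y.1, y.2.1⟩ y.2.2
  rw [mapSec_resSec] at this
  exact this ⟨x.1, x.2, hV⟩

end HyperSheaf

theorem eq_of_prime_mem_asIdeal {q r : PrimeSpectrum ℤ} {p : ℕ} (hp : p.Prime)
    (hq : (p : ℤ) ∈ q.asIdeal) (hr : (p : ℤ) ∈ r.asIdeal) : q = r := by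
  have hmax : (Ideal.span {(p : ℤ)}).IsMaximal :=
    PrincipalIdealRing.isMaximal_of_irreducible (Nat.prime_iff_prime_int.mp hp).irreducible
  have key : ∀ s : PrimeSpectrum ℤ, (p : ℤ) ∈ s.asIdeal → Ideal.span {(p : ℤ)} = s.asIdeal :=
    fun s hs => hmax.eq_of_le s.isPrime.ne_top ((Ideal.span_singleton_le_iff_mem _).mpr hs)
  exact PrimeSpectrum.ext ((key q hq).symm.trans (key r hr))

/-- Control at all points at once is needed to match `g` with a tensor supported on one fibre of
`specMap`. -/
theorem exists_forall_isPointValuation_eq {P : PrimeSpectrum Ocyc} {r : ℚ}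
    (hr : r ∈ valueGroup (specMap P)) :
    ∃ g : Qcyc, ∀ (Q : PrimeSpectrum Ocyc) (w : AddValuation Qcyc (WithTop ℚ)),
      IsPointValuation Q w →
        (specMap Q = specMap P → w g = r) ∧ (specMap Q ≠ specMap P → w g = 0) := by
  rcases hr with rfl | ⟨p, hp, hP, hr⟩
  · exact ⟨1, fun Q w _ => ⟨fun _ => w.map_one, fun _ => w.map_one⟩⟩
  · obtain ⟨g, -, h₁, h₂⟩ := exists_forall_isNormalizedValuation_eq hp hr
    refine ⟨g, fun Q w hw => ⟨fun h => h₁ Q w (hw.isNormalized p hp ?_), fun h => ?_⟩⟩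
    · rw [← natCast_mem_specMap_iff, h]; exact hP
    · refine (AddValuation.eq_zero_iff_isLocalUnit hw.nonneg_iff).mpr (h₂ Q fun hQ => h ?_)
      exact eq_of_prime_mem_asIdeal hp (natCast_mem_specMap_iff.mpr hQ) hP

/-- Every germ of a Cartier divisor class extends to a class whose image under a family of maps
which negates valuations is a section of `(Θ ∘ π)^* 𝒪_h`. -/
theorem exists_pred_cartierSheaf_of_stalkValue_eq
    (φ : ∀ P, (cartierSheaf Ocyc Qcyc).stalk P ≃ pullbackStructureSheaf.stalk P)
    {w : ∀ _ : PrimeSpectrum Ocyc, AddValuation Qcyc (WithTop ℚ)}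
    (hw : ∀ P, IsPointValuation P (w P))
    (hφ : ∀ P f, stalkValue (specMap P) (φ P (UnitQuotient.mk (localUnits Ocyc Qcyc P) f)) =
      negValue (w P f)) (P : PrimeSpectrum Ocyc) (t : (cartierSheaf Ocyc Qcyc).stalk P) :
    ∃ (U : Opens (TopCat.of (PrimeSpectrum Ocyc))) (hP : P ∈ U)
      (s : ∀ Q : U, (cartierSheaf Ocyc Qcyc).stalk Q.1), (cartierSheaf Ocyc Qcyc).sec.pred s ∧
        pullbackStructureSheaf.sec.pred (fun Q => φ Q.1 (s Q)) ∧ s ⟨P, hP⟩ = t := by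
  have key : ∀ (g : Qcyc) (x : WithBot ℤ) (c : thetaStalk (specMap P)),
      (∀ Q, scaleBot (thetaSingle (specMap P) c (specMap Q)) x = negValue (w Q g)) →
      UnitQuotient.mk (localUnits Ocyc Qcyc P) g = t →
      ∃ (U : Opens (TopCat.of (PrimeSpectrum Ocyc))) (hP : P ∈ U)
        (s : ∀ Q : U, (cartierSheaf Ocyc Qcyc).stalk Q.1), (cartierSheaf Ocyc Qcyc).sec.pred s ∧
        pullbackStructureSheaf.sec.pred (fun Q => φ Q.1 (s Q)) ∧ s ⟨P, hP⟩ = t := by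
    intro g x c h ht
    refine ⟨⊤, trivial, _, cartierSheaf_pred_mk Ocyc ⊤ g, ?_, ht⟩
    refine (congrArg pullbackStructureSheaf.sec.pred (funext fun Q => ?_)).mpr
      (pullbackStructureSheaf_pred_stalkTmul ⊤ x (specMap P) c)
    refine stalkValue_injective _ ?_
    rw [hφ, ← h Q.1]
    rfl
  obtain ⟨f, rfl⟩ := exists_mk_eq t
  by_cases hf : f = 0
  · exact key 0 ⊥ (thetaZero _) (fun Q => by rw [(w Q).map_zero]; rfl) (by rw [hf])
  · obtain ⟨r, hr⟩ := (w P).exists_rat_eq hf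
    have hr' := ((hw P).exists_eq_iff r).mp ⟨f, hr⟩
    -- `f` is replaced by an element `g` of the same class at `P` whose values elsewhere are known;
    -- `-r = m c` then supplies the tensor `m ⊗ c`.
    obtain ⟨g, hg⟩ := exists_forall_isPointValuation_eq hr'
    obtain ⟨c, ⟨m, hm⟩, -⟩ := exists_common_divisor (neg_mem hr') (neg_mem hr') (neg_mem hr')
    refine key g m c (fun Q => ?_) ((mk_eq_mk_iff_valuation_eq (hw P).nonneg_iff).mpr ?_)
    · by_cases h : specMap Q = specMap P
      · rw [(hg Q _ (hw Q)).1 h, negValue_coe, hm, h, thetaSingle_same]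
        rfl
      · rw [(hg Q _ (hw Q)).2 h, thetaSingle_of_ne c h]
        exact congrArg (fun z : ℚ => (z : WithBot ℚ)) ((mul_zero _).trans neg_zero.symm)
    · rw [(hg P _ (hw P)).1 rfl, hr]

theorem proposition4p7 :
    (∀ (p : ℕ) (P : PrimeSpectrum Ocyc), p.Prime → (p : Ocyc) ∈ P.asIdeal →
      ∃! v : AddValuation Qcyc (WithTop ℚ), IsNormalizedValuation p P v) ∧
    (∀ (p : ℕ) (P : PrimeSpectrum Ocyc) (v : AddValuation Qcyc (WithTop ℚ)),
      p.Prime → (p : Ocyc) ∈ P.asIdeal → IsNormalizedValuation p P v →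
      {r : ℚ | ∃ f : Qcyc, v f = (r : WithTop ℚ)} = (fractionGroup p : Set ℚ)) ∧
    (cartierSheaf Ocyc Qcyc).IsSheafOfHyperrings ∧
    pullbackStructureSheaf.IsSheafOfHyperrings ∧
    ∃! Φ : (cartierSheaf Ocyc Qcyc).toSheaf ≅ pullbackStructureSheaf.toSheaf,
      HyperSheaf.IsHyperringIso Φ ∧
      ∀ (U : Opens (TopCat.of (PrimeSpectrum Ocyc)))
        (s : (cartierSheaf Ocyc Qcyc).Sections U) (P : U) (f : Qcyc),
        (cartierSheaf Ocyc Qcyc).germ s P =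
          UnitQuotient.mk (localUnits Ocyc Qcyc P.1) f →
        ∀ (p : ℕ) (v : AddValuation Qcyc (WithTop ℚ)), p.Prime → (p : Ocyc) ∈ P.1.asIdeal →
          IsNormalizedValuation p P.1 v →
          stalkValue (specMap P.1)
            (pullbackStructureSheaf.germ (HyperSheaf.mapSec Φ s) P) = negValue (v f) := by
  choose w hw using exists_isPointValuation
  have HC : ∀ P, ((cartierSheaf Ocyc Qcyc).str P).IsTropical (valueGroup (specMap P))
      (negValuation (hw P).nonneg_iff) := fun P =>
    isTropical_negValuation _ (exists_isLocalUnit_one_sub P) (hw P).exists_eq_iff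
  have HT : ∀ P, (pullbackStructureSheaf.str P).IsTropical (valueGroup (specMap P))
      (stalkValue (specMap P)) := fun P => isTropical_stalkValue (specMap P)
  have hC : (cartierSheaf Ocyc Qcyc).IsSheafOfHyperrings :=
    isSheafOfHyperrings_cartierSheaf fun P => (HC P).isHyperring
  refine ⟨fun p P hp hP => existsUnique_isNormalizedValuation hp hP, ?_, hC,
    isSheafOfHyperrings_pullbackStructureSheaf, ?_⟩
  · intro p P v hp hP hv
    ext r
    refine ⟨fun ⟨f, hf⟩ => hv.mem_fractionGroup hp hP hf, fun hr => ?_⟩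
    obtain ⟨g, -, hg, -⟩ := exists_forall_isNormalizedValuation_eq hp hr
    exact ⟨g, hg P v hv⟩
  · choose φ hφ using fun P => (HC P).exists_equiv (HT P)
    have hsec := fun U : Opens (TopCat.of (PrimeSpectrum Ocyc)) => pred_comp_iff (U := U) (germExt_cartierSheaf Ocyc Qcyc) germExt_pullbackStructureSheaf φ
      (exists_pred_cartierSheaf_of_stalkValue_eq φ hw fun P f => hφ P _)
    have hiso := isHyperringIso_isoOfStalkEquiv φ (fun {U} => hsec U) HC HT hφ
    have hval : ∀ (U : Opens (TopCat.of (PrimeSpectrum Ocyc)))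
        (s : (cartierSheaf Ocyc Qcyc).Sections U) (P : U) (f : Qcyc),
        (cartierSheaf Ocyc Qcyc).germ s P = UnitQuotient.mk (localUnits Ocyc Qcyc P.1) f →
        stalkValue (specMap P.1) (pullbackStructureSheaf.germ
          (mapSec (isoOfStalkEquiv φ fun {U} => hsec U) s) P) = negValue (w P.1 f) := by
      intro U s P f h
      rw [germ_mapSec_isoOfStalkEquiv, h]
      exact hφ P.1 _
    refine ⟨isoOfStalkEquiv φ fun {U} => hsec U, ⟨hiso, ?_⟩, ?_⟩
    · intro U s P f h p v hp hP hv
      rw [hval U s P f h,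
        (existsUnique_isNormalizedValuation hp hP).unique hv ((hw P.1).isNormalized p hp hP)]
    · rintro Ψ ⟨hΨ, hΨval⟩
      refine iso_ext fun U s P => ?_
      obtain ⟨f, hf⟩ := exists_mk_eq ((cartierSheaf Ocyc Qcyc).germ s P)
      rcases eq_bot_or_exists_prime_mem P.1 with h | ⟨p, hp, hP⟩
      -- No value is prescribed at the generic point, but the germ there is `0` or `1`, and both
      -- isomorphisms preserve these.
      · by_cases h0 : f = 0
        · rw [h0] at hf
          rw [germ_mapSec_eq_zero hC hΨ s P hf.symm, germ_mapSec_eq_zero hC hiso s P hf.symm]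
        · have h1 : UnitQuotient.mk (localUnits Ocyc Qcyc P.1) f = UnitQuotient.mk _ 1 :=
            mk_eq_mk_iff.mpr ⟨f, isLocalUnit_of_asIdeal_eq_bot h h0, (mul_one f).symm⟩
          have h2 := hf.symm.trans h1
          rw [germ_mapSec_eq_one hC hΨ s P h2, germ_mapSec_eq_one hC hiso s P h2]
      · refine stalkValue_injective _ ?_
        rw [hval U s P f hf.symm]
        exact hΨval U s P f hf.symm p (w P.1) hp hP ((hw P.1).isNormalized p hp hP)
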